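/- Let $N,M\ge 0$ be integers, let $\eta,\xi_1,\dots,\xi_N\in\mathbb{C}$ and $\mathcal{H}=\bigotimes_{n=1}^N\mathbb{C}^2$. Let $R(\lambda)\in\mathrm{End}(\mathbb{C}^2\otimes\mathbb{C}^2)$ be the 6-vertex $R$-matrix $$R(\lambda)=\begin{pmatrix}\sinh(\lambda+\eta)&0&0&0\\0&\sinh\lambda&\sinh\eta&0\\0&\sinh\eta&\sinh\lambda&0\\0&0&0&\sinh(\lambda+\eta)\end{pmatrix}$$ and let $\bar R(\lambda)$ be the same matrix with $\eta$ replaced by $-\eta$. On $V_0\otimes\mathcal{H}$ with $V_0=\mathbb{C}^2$ put $$T(\lambda)=R_{01}(\lambda-\xi_1-\tfrac\eta2)\cdots R_{0N}(\lambda-\xi_N-\tfrac\eta2),\qquad \hat T(\lambda)=R_{0N}(\lambda+\xi_N-\tfrac\eta2)\cdots R_{01}(\lambda+\xi_1-\tfrac\eta2),$$ $$M(\lambda)=\bar R_{0N}(\lambda-\xi_N+\tfrac\eta2)\cdots\bar R_{01}(\lambda-\xi_1+\tfrac\eta2).$$ Let $\varsigma_+,\kappa_+,\tau_+,\varphi_+,\psi_+\in\mathbb{C}$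 with $\sinh\varsigma_+\ne0$, $\kappa_+\neq 0$, $$\sinh\varphi_+\cosh\psi_+=\frac{\sinh\varsigma_+}{2\kappa_+},\qquad \cosh\varphi_+\sinh\psi_+=\frac{\cosh\varsigma_+}{2\kappa_+},$$ and consider the boundary matrix and the boundary monodromy matrix $$K_-(\lambda)=\frac1{\sinh\varsigma_+}\begin{pmatrix}\sinh(\lambda-\frac\eta2+\varsigma_+)&\kappa_+e^{\tau_+}\sinh(2\lambda-\eta)\\ \kappa_+e^{-\tau_+}\sinh(2\lambda-\eta)&\sinh(\varsigma_+-\lambda+\frac\eta2)\end{pmatrix},\qquad \mathcal{U}_-(\lambda)=T(\lambda)K_-(\lambda)\hat T(\lambda).$$ With $S(\lambda|\alpha,\beta)=\begin{pmatrix}e^{\lambda-\eta(\beta+\alpha)}&e^{\lambda+\eta(\beta-\alpha)}\\1&1\end{pmatrix}$ acting on $V_0$, let $\mathcal{B}_-(\lambda|\alpha,\beta)$ be the upper right entry of $S^{-1}(\frac\eta2-\lambda|\alpha,\beta)\,\mathcal{U}_-(\lambda)\,S(\lambda-\frac\eta2|\alpha,\beta)$ and set $$\widehat{\mathcal{B}}_-(\lambda|\alpha-\beta)=\sinh(\eta\beta)\,e^{-\eta\beta}e^{-(\lambda-\eta/2)}\,\mathcal{B}_-(\lambda|\alpha,\beta),$$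 which depends on $\alpha,\beta$ only through $\alpha-\beta$. Let $B(\lambda|\alpha-\beta,\gamma-\delta)$ be $2\sinh(\eta\beta)\,e^{-\eta(\alpha+1/2)}$ times the upper right entry of $S^{-1}(-\frac\eta2-\lambda|\alpha,\beta)\,M(\lambda)\,S(-\frac\eta2-\lambda|\gamma,\delta)$, which depends only on $\lambda$, $\alpha-\beta$ and $\gamma-\delta$. (Both operators are defined, for every complex value of the differences, by choosing any $\beta$ with $\sinh(\eta\beta)\ne0$, and by continuity if $\eta=0$.) Let $$|\eta,x\rangle=\bigotimes_{n=1}^N\begin{pmatrix}e^{-(n-N+x)\eta-\xi_n}\\1\end{pmatrix},\qquad a(\lambda)=\prod_{n=1}^N\sinh(\lambda-\xi_n+\tfrac\eta2),$$ $$\textsc{a}_{\epsilon}(\lambda)=\frac{\sinh(\lambda-\frac\eta2+\epsilon\varphi_+)\cosh(\lambda-\frac\eta2+\epsilon\psi_+)}{\sinh(\epsilon\varphi_+)\cosh(\epsilon\psi_+)}.$$ Let $\epsilon_+\in\{1,-1\}$, and let $\gamma,\delta\in\mathbb{C}$ satisfy $$\eta\gamma=-\tau_++\epsilon_+\tfrac{i\pi}2,\qquad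 \eta\delta=-\epsilon_+(\varphi_++\psi_+)-\tfrac{i\pi}2 .$$ Let $\alpha,\beta\in\mathbb{C}$ be arbitrary, and let $\lambda_1,\dots,\lambda_M\in\mathbb{C}$. Assume that the denominators below do not vanish: $\sinh(\eta(\delta+j))\neq0$ for $1\le j\le M$, $\sinh(2\lambda_n)\ne0$ for all $n$, and $\sinh(\lambda_a\pm\lambda_b)\ne0$ for all $a\ne b$. Then $$\widehat{\mathcal{B}}_-(\lambda_1|\alpha-\beta+1)\,\widehat{\mathcal{B}}_-(\lambda_2|\alpha-\beta+3)\cdots\widehat{\mathcal{B}}_-(\lambda_M|\alpha-\beta+2M-1)\,|\eta,\gamma+\delta\rangle$$ $$=h_M\sum_{\sigma_1,\dots,\sigma_M=\pm1}H_{\sigma_1,\dots,\sigma_M}\;B(\sigma_M\lambda_M|\gamma-\delta-1,\alpha-\beta)\,B(\sigma_{M-1}\lambda_{M-1}|\gamma-\delta-2,\alpha-\beta+1)\cdots B(\sigma_1\lambda_1|\gamma-\delta-M,\alpha-\beta+M-1)\,|\eta,\gamma+\delta+M\rangle,$$ where $$H_{\sigma_1,\dots,\sigma_M}=\prod_{n=1}^M\left[\sigma_n\,a(-\sigma_n\lambda_n)\,\textsc{a}_{\epsilon_+}(-\sigma_n\lambda_n)\,\frac{\sinh(2\lambda_n-\eta)}{\sinh2\lambda_n}\right]\prod_{1\le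 a<b\le M}\frac{\sinh(\sigma_a\lambda_a+\sigma_b\lambda_b+\eta)}{\sinh(\sigma_a\lambda_a+\sigma_b\lambda_b)},$$ $$h_M=(-1)^{MN}e^{M\eta\frac{\gamma-\delta+\alpha-\beta+N}2}\prod_{j=1}^M\frac{\sinh\big(\eta\,\frac{\alpha-\beta-\gamma-\delta+N-1+2j}2\big)}{2\sinh(\eta(\delta+j))}.$$ -/

import Mathlib

open scoped Matrix

noncomputable section

namespace OpenXXZ

/-- Operators on the `N`-site spin-1/2 space `⊗ₙ ℂ²`, as matrices in the canonical product basis.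
A basis vector is a configuration `s : Fin N → Fin 2` (`0` is spin up, `1` is spin down), and
site `n` of the chain, `1 ≤ n ≤ N`, is the index `n - 1`. -/
abbrev Op (N : ℕ) : Type := Matrix (Fin N → Fin 2) (Fin N → Fin 2) ℂ

/-- Vectors of the spin chain space `⊗ₙ ℂ²`, in the canonical product basis. -/
abbrev State (N : ℕ) : Type := (Fin N → Fin 2) → ℂ

/-- Matrices in the auxiliary space `V₀ = ℂ²`, whose entries are operators on the chain, that is,
elements of `End (V₀ ⊗ ℋ)`. -/
abbrev AuxOp (N : ℕ) : Type := Matrix (Fin 2) (Fin 2) (Op N)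

/-- The operator acting as the `2 × 2` matrix `A` on site `n` and as the identity elsewhere. -/
def siteOp {N : ℕ} (n : Fin N) (A : Matrix (Fin 2) (Fin 2) ℂ) : Op N :=
  Matrix.of fun s t => if ∀ m, m ≠ n → s m = t m then A (s n) (t n) else 0

/-- A scalar `2 × 2` matrix seen as acting on the auxiliary space only. -/
def auxScalar (N : ℕ) (A : Matrix (Fin 2) (Fin 2) ℂ) : AuxOp N :=
  A.map (algebraMap ℂ (Op N))

/-- The trigonometric 6-vertex `R`-matrix on `ℂ² ⊗ ℂ²`. -/
def Rmat (η l : ℂ) : Matrix (Fin 2 × Fin 2) (Fin 2 × Fin 2) ℂ :=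
  Matrix.of fun p q =>
    if p = q then (if p.1 = p.2 then Complex.sinh (l + η) else Complex.sinh l)
    else if p = q.swap then Complex.sinh η else 0

/-- `R₀ₙ(l)`: the `R`-matrix acting on the auxiliary space and on site `n`. -/
def R0 {N : ℕ} (η : ℂ) (n : Fin N) (l : ℂ) : AuxOp N :=
  Matrix.of fun i j => siteOp n (Matrix.of fun a b => Rmat η l (i, a) (j, b))

/-- `T₀(l) = R₀₁(l - ξ₁ - η/2) ⋯ R₀N(l - ξN - η/2)`. -/
def monodromyT {N : ℕ} (η : ℂ) (ξ : Fin N → ℂ) (l : ℂ) : AuxOp N :=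
  (List.ofFn fun n : Fin N => R0 η n (l - ξ n - η / 2)).prod

/-- `T̂₀(l) = R₀N(l + ξN - η/2) ⋯ R₀₁(l + ξ₁ - η/2)`. -/
def monodromyThat {N : ℕ} (η : ℂ) (ξ : Fin N → ℂ) (l : ℂ) : AuxOp N :=
  (List.ofFn fun n : Fin N => R0 η n.rev (l + ξ n.rev - η / 2)).prod

/-- The scalar boundary matrix `K(l; ς, κ, τ)`. -/
def Kmat (η ς κ τ l : ℂ) : Matrix (Fin 2) (Fin 2) ℂ :=
  (1 / Complex.sinh ς) •
    !![Complex.sinh (l - η / 2 + ς), κ * Complex.exp τ * Complex.sinh (2 * l - η);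
       κ * Complex.exp (-τ) * Complex.sinh (2 * l - η), Complex.sinh (ς - l + η / 2)]

/-- The boundary monodromy matrix `𝒰₋(l) = T(l) K₋(l) T̂(l)`. -/
def boundaryU {N : ℕ} (η : ℂ) (ξ : Fin N → ℂ) (ς κ τ l : ℂ) : AuxOp N :=
  monodromyT η ξ l * auxScalar N (Kmat η ς κ τ l) * monodromyThat η ξ l

/-- The bulk monodromy matrix `M(l) = R̄₀N(l - ξN + η/2) ⋯ R̄₀₁(l - ξ₁ + η/2)`, where `R̄` is the
`R`-matrix with `η` replaced by `-η`. -/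
def bulkM {N : ℕ} (η : ℂ) (ξ : Fin N → ℂ) (l : ℂ) : AuxOp N :=
  (List.ofFn fun n : Fin N => R0 (-η) n.rev (l - ξ n.rev + η / 2)).prod

/-- The vertex-IRF gauge matrix `S(l | α, β)`. -/
def Smat (η l α β : ℂ) : Matrix (Fin 2) (Fin 2) ℂ :=
  !![Complex.exp (l - η * (β + α)), Complex.exp (l + η * (β - α)); 1, 1]

/-- The gauged boundary monodromy matrix
`𝒰₋(l | α, β) = S⁻¹(η/2 - l | α, β) 𝒰₋(l) S(l - η/2 | α, β)`. -/
def gaugedU {N : ℕ} (η : ℂ) (ξ : Fin N → ℂ) (ς κ τ l α β : ℂ) : AuxOp N :=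
  auxScalar N (Smat η (η / 2 - l) α β)⁻¹ * boundaryU η ξ ς κ τ l *
    auxScalar N (Smat η (l - η / 2) α β)

/-- The gauged bulk monodromy matrix
`M(l | (α, β), (γ, δ)) = S⁻¹(-η/2 - l | α, β) M(l) S(-η/2 - l | γ, δ)`. -/
def gaugedM {N : ℕ} (η : ℂ) (ξ : Fin N → ℂ) (l α β γ δ : ℂ) : AuxOp N :=
  auxScalar N (Smat η (-η / 2 - l) α β)⁻¹ * bulkM η ξ l *
    auxScalar N (Smat η (-η / 2 - l) γ δ)

/-- The boundary creation operator `ℬ̂₋(l | z)`, a function of `z = α - β` alone, such that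
`ℬ̂₋(l | α - β) = sinh(ηβ) e^{-ηβ} e^{-(l - η/2)} ℬ₋(l | α, β)`, where `ℬ₋(l | α, β)` is the
upper right entry of `𝒰₋(l | α, β)`; see `boundaryBhat_sub`. The determinant in the inverse of `S`
has been cancelled here, so that the definition does not need an auxiliary `β` with
`sinh(ηβ) ≠ 0`. -/
def boundaryBhat {N : ℕ} (η : ℂ) (ξ : Fin N → ℂ) (ς κ τ l z : ℂ) : Op N :=
  (-(Complex.exp (η * z) / 2)) •
    (auxScalar N (Smat η (η / 2 - l) z 0).adjugate * boundaryU η ξ ς κ τ l *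
      auxScalar N (Smat η (l - η / 2) z 0)) 0 1

/-- The bulk creation operator `B(l | x, y)`, such that the upper right entry of
`M(l | (α, β), (γ, δ))` is `e^{η(α + 1/2)} / (2 sinh(ηβ)) B(l | α - β, γ - δ)`;
see `gaugedM_zero_one`. -/
def bulkB {N : ℕ} (η : ℂ) (ξ : Fin N → ℂ) (l x y : ℂ) : Op N :=
  (-Complex.exp l) •
    (auxScalar N (Smat η (-η / 2 - l) x 0).adjugate * bulkM η ξ l *
      auxScalar N (Smat η (-η / 2 - l) y 0)) 0 1

theorem aux_entry {N : ℕ} (A B : Matrix (Fin 2) (Fin 2) ℂ) (X : AuxOp N) :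
    (auxScalar N A * X * auxScalar N B) 0 1 =
      (A 0 0 * B 0 1) • X 0 0 + (A 0 1 * B 0 1) • X 1 0 +
        (A 0 0 * B 1 1) • X 0 1 + (A 0 1 * B 1 1) • X 1 1 := by
  simp only [auxScalar, Matrix.mul_apply, Fin.sum_univ_two, Matrix.map_apply,
    Algebra.algebraMap_eq_smul_one, smul_mul_assoc, mul_smul_comm, one_mul, mul_one, smul_add,
    smul_smul]
  module

theorem det_Smat (η l α β : ℂ) :
    (Smat η l α β).det = -(2 * Complex.sinh (η * β) * Complex.exp (l - η * α)) := by
  have h1 : Complex.exp (l - η * (β + α)) = Complex.exp (l - η * α) * Complex.exp (-(η * β)) := by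
    rw [← Complex.exp_add]; ring_nf
  have h2 : Complex.exp (l + η * (β - α)) = Complex.exp (l - η * α) * Complex.exp (η * β) := by
    rw [← Complex.exp_add]; ring_nf
  rw [Smat, Matrix.det_fin_two_of, h1, h2, Complex.two_sinh]
  ring

theorem Smat_inv (η l α β : ℂ) :
    (Smat η l α β)⁻¹ = (-(2 * Complex.sinh (η * β) * Complex.exp (l - η * α)))⁻¹ •
      (Smat η l α β).adjugate := by
  rw [Matrix.inv_def, det_Smat, Ring.inverse_eq_inv']

theorem boundaryBhat_sub {N : ℕ} (η : ℂ) (ξ : Fin N → ℂ) (ς κ τ l α β : ℂ)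
    (hβ : Complex.sinh (η * β) ≠ 0) :
    boundaryBhat η ξ ς κ τ l (α - β) =
      (Complex.sinh (η * β) * Complex.exp (-(η * β)) * Complex.exp (-(l - η / 2))) •
        gaugedU η ξ ς κ τ l α β 0 1 := by
  have hc : Complex.sinh (η * β) * Complex.exp (-(η * β)) * Complex.exp (-(l - η / 2)) *
      (-(2 * Complex.sinh (η * β) * Complex.exp (η / 2 - l - η * α)))⁻¹ =
      -(Complex.exp (η * (α - β)) / 2) := by
    have h : Complex.exp (-(η * β)) * Complex.exp (-(l - η / 2)) =
        Complex.exp (η * (α - β)) * Complex.exp (η / 2 - l - η * α) := by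
      rw [← Complex.exp_add, ← Complex.exp_add]; ring_nf
    have h3 := Complex.exp_ne_zero (η / 2 - l - η * α)
    rw [mul_assoc (Complex.sinh (η * β)), h]
    field_simp
  have e1 : η / 2 - l + η * (0 - (α - β)) = η / 2 - l + η * (β - α) := by ring
  have e2 : l - η / 2 + η * (0 - (α - β)) = l - η / 2 + η * (β - α) := by ring
  rw [boundaryBhat, gaugedU, Smat_inv, aux_entry, aux_entry, ← hc]
  simp only [Matrix.smul_apply, Smat, Matrix.adjugate_fin_two_of, Matrix.of_apply,
    Matrix.cons_val_zero, Matrix.cons_val_one, Matrix.cons_val', smul_eq_mul, e1, e2]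
  module

theorem gaugedM_zero_one {N : ℕ} (η : ℂ) (ξ : Fin N → ℂ) (l α β γ δ : ℂ)
    (hβ : Complex.sinh (η * β) ≠ 0) :
    gaugedM η ξ l α β γ δ 0 1 =
      (Complex.exp (η * (α + 1 / 2)) / (2 * Complex.sinh (η * β))) •
        bulkB η ξ l (α - β) (γ - δ) := by
  have hc : Complex.exp (η * (α + 1 / 2)) / (2 * Complex.sinh (η * β)) * (-Complex.exp l) =
      (-(2 * Complex.sinh (η * β) * Complex.exp (-η / 2 - l - η * α)))⁻¹ := by
    have h : Complex.exp (η * (α + 1 / 2)) * Complex.exp l *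
        Complex.exp (-η / 2 - l - η * α) = 1 := by
      rw [← Complex.exp_add, ← Complex.exp_add, Complex.exp_eq_one_iff]
      exact ⟨0, by push_cast; ring⟩
    have h3 := Complex.exp_ne_zero (-η / 2 - l - η * α)
    refine eq_inv_of_mul_eq_one_left ?_
    generalize Complex.exp (η * (α + 1 / 2)) = a at h ⊢
    generalize Complex.exp (-η / 2 - l - η * α) = b at h h3 ⊢
    field_simp
    linear_combination h
  have e1 : -η / 2 - l + η * (0 - (α - β)) = -η / 2 - l + η * (β - α) := by ring
  have e2 : -η / 2 - l + η * (0 - (γ - δ)) = -η / 2 - l + η * (δ - γ) := by ring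
  rw [bulkB, gaugedM, Smat_inv, aux_entry, aux_entry, smul_smul, hc]
  simp only [Matrix.smul_apply, Smat, Matrix.adjugate_fin_two_of, Matrix.of_apply,
    Matrix.cons_val_zero, Matrix.cons_val_one, Matrix.cons_val', smul_eq_mul, e1, e2]
  module

/-- The gauge reference state `|η, x⟩ = ⊗ₙ (e^{-(n - N + x)η - ξₙ}, 1)ᵗ`. -/
def refState {N : ℕ} (η : ℂ) (ξ : Fin N → ℂ) (x : ℂ) : State N :=
  fun s => ∏ n : Fin N,
    (![Complex.exp (-(((n : ℕ) : ℂ) + 1 - N + x) * η - ξ n), 1] : Fin 2 → ℂ) (s n)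

/-- `ℬ̂₋(λ₁ | z) ℬ̂₋(λ₂ | z + 2) ⋯ ℬ̂₋(λ_M | z + 2M - 2)`, at `z = α - β + 1` the operator
creating the boundary Bethe state. -/
def boundaryBhatProd {N M : ℕ} (η : ℂ) (ξ : Fin N → ℂ) (ς κ τ : ℂ) (lam : Fin M → ℂ) (z : ℂ) :
    Op N :=
  (List.ofFn fun j : Fin M => boundaryBhat η ξ ς κ τ (lam j) (z + 2 * ((j : ℕ) : ℂ))).prod

/-- `B(μ_M | x - 1, y) B(μ_{M-1} | x - 2, y + 1) ⋯ B(μ₁ | x - M, y + M - 1)`. -/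
def bulkBProd {N M : ℕ} (η : ℂ) (ξ : Fin N → ℂ) (μ : Fin M → ℂ) (x y : ℂ) : Op N :=
  (List.ofFn fun k : Fin M =>
    bulkB η ξ (μ k.rev) (x - (((k : ℕ) : ℂ) + 1)) (y + ((k : ℕ) : ℂ))).prod

/-- `a(l) = ∏ₙ sinh(l - ξₙ + η/2)`. -/
def aFun {N : ℕ} (η : ℂ) (ξ : Fin N → ℂ) (l : ℂ) : ℂ :=
  ∏ n : Fin N, Complex.sinh (l - ξ n + η / 2)

/-- The boundary coefficient `ᴀ(l)` with boundary parameters `φ`, `ψ`; the coefficient with sign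
`ε` is obtained at `εφ`, `εψ`. -/
def aBoundary (η φ ψ l : ℂ) : ℂ :=
  Complex.sinh (l - η / 2 + φ) * Complex.cosh (l - η / 2 + ψ) /
    (Complex.sinh φ * Complex.cosh ψ)

/-- The complex number `±1` given by a sign. -/
def sgn (s : ℤˣ) : ℂ := ((s : ℤ) : ℂ)

/-- The coefficient `H_{σ₁,…,σ_M}({λᵢ} | φ, ψ)`. -/
def Hcoeff {N M : ℕ} (η : ℂ) (ξ : Fin N → ℂ) (φ ψ : ℂ) (σ : Fin M → ℤˣ) (lam : Fin M → ℂ) : ℂ :=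
  (∏ n : Fin M, (sgn (σ n) * aFun η ξ (-(sgn (σ n) * lam n)) *
      aBoundary η φ ψ (-(sgn (σ n) * lam n)) *
      (Complex.sinh (2 * lam n - η) / Complex.sinh (2 * lam n)))) *
  ∏ a : Fin M, ∏ b ∈ Finset.Ioi a,
    (Complex.sinh (sgn (σ a) * lam a + sgn (σ b) * lam b + η) /
      Complex.sinh (sgn (σ a) * lam a + sgn (σ b) * lam b))

/-- The coefficient `h_M(x, y, z)`, to be taken at `x = γ - δ`, `y = α - β`, `z = γ + δ`, so that
`δ = (z - x) / 2`. -/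
def hcoeff (N M : ℕ) (η x y z : ℂ) : ℂ :=
  (-1) ^ (M * N) * Complex.exp ((M : ℂ) * η * ((x + y + N) / 2)) *
    ∏ j ∈ Finset.Icc 1 M,
      (Complex.sinh (η * ((y - z + N - 1 + 2 * (j : ℂ)) / 2)) /
        (2 * Complex.sinh (η * ((z - x) / 2 + (j : ℂ)))))

end OpenXXZ

end

namespace OpenXXZ

/-! The boundary operator is quadratic in the bulk one. By crossing symmetry `T(l)` is the adjugate
of `M(l)` in the auxiliary space, and `T̂(l) = (-1)^N M(-l)`; hence `ℬ̂₋(l)` is a bilinear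
expression in the entries of `M(l)` and `M(-l)` whose left indices are contracted by a form built
from `K₋` (`boundaryBhat_eq_pairEntry`). At the prescribed `γ`, `δ` this form is a combination of
two terms only: a product of gauge covectors, and the `R̄`-image of such a product
(`boundaryForm_eq`). The exchange relation of `M` then gives `ℬ̂₋(l | y + 1)` as a sum over `s = ±1`
of multiples of `B(sl | γ-δ-1, y) B(-sl | γ+δ, y+1)` (`boundaryBhat_decomposition`).

The theorem follows by induction on `M`, adding the leftmost operator. In each term the factor
`B(-sλ | γ+δ, y+1)` is pushed to the right through the product supplied by the induction hypothesis.
Each exchange raises its first argument by one, so on arrival it matches the height of the reference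
state and acts there by a scalar (`bulkB_mulVec_refState`). The result is algebraic Bethe ansatz in
form (`bulkB_mulVec_bulkBSet`): one direct term, which builds the new product, and exchanged terms
in which some `B(σⱼλⱼ)` has been absorbed and `B(-sλ)` remains.

An exchanged term contains `B(sλ) B(-sλ)`, which is even in `s`, and its vector no longer depends on
`σⱼ`. Its coefficient summed over `s` and `σⱼ` vanishes by a four-term identity for the boundary
coefficients (`boundary_cancellation`, `unwanted_coeff_cancel`). The direct terms reproduce the
recursions of `Hcoeff` and `hcoeff`. -/

/-! ### Algebra of one-site operators. -/

theorem siteOp_mulVec {N : ℕ} (n : Fin N) (A : Matrix (Fin 2) (Fin 2) ℂ) (v : State N)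
    (s : Fin N → Fin 2) :
    (siteOp n A).mulVec v s = ∑ a, A (s n) a * v (Function.update s n a) := by
  classical
  have hinj : Function.Injective (fun a : Fin 2 => Function.update s n a) := by
    intro a b h
    simpa using congrFun h n
  rw [Matrix.mulVec, dotProduct, ← Finset.sum_subset (Finset.subset_univ
    (Finset.univ.map ⟨fun a : Fin 2 => Function.update s n a, hinj⟩)), Finset.sum_map]
  · refine Finset.sum_congr rfl fun a _ => ?_
    have h : ∀ m, m ≠ n → s m = Function.update s n a m := fun m hm => by simp [hm]
    simp only [siteOp, Matrix.of_apply, Function.Embedding.coeFn_mk, if_pos h,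
      Function.update_self]
  · intro t _ ht
    have h : ¬ ∀ m, m ≠ n → s m = t m := by
      intro h
      refine ht (Finset.mem_map.2 ⟨t n, Finset.mem_univ _, ?_⟩)
      funext m
      by_cases hm : m = n
      · subst hm; simp
      · simp [hm, h m hm]
    simp only [siteOp, Matrix.of_apply, if_neg h, zero_mul]

theorem siteOp_commute {N : ℕ} {n m : Fin N} (h : n ≠ m) (A B : Matrix (Fin 2) (Fin 2) ℂ) :
    Commute (siteOp n A) (siteOp m B) := by
  rw [Commute, SemiconjBy]
  refine Matrix.ext_of_mulVec_single fun t => ?_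
  rw [← Matrix.mulVec_mulVec, ← Matrix.mulVec_mulVec]
  generalize (Pi.single t 1 : State N) = v
  funext s
  simp only [siteOp_mulVec, Function.update_of_ne h, Function.update_of_ne h.symm,
    Finset.mul_sum]
  rw [Finset.sum_comm]
  refine Finset.sum_congr rfl fun a _ => Finset.sum_congr rfl fun b _ => ?_
  rw [Function.update_comm h]
  ring

theorem siteOp_mul {N : ℕ} (n : Fin N) (A B : Matrix (Fin 2) (Fin 2) ℂ) :
    siteOp n A * siteOp n B = siteOp n (A * B) := by
  refine Matrix.ext_of_mulVec_single fun t => ?_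
  rw [← Matrix.mulVec_mulVec]
  generalize (Pi.single t 1 : State N) = v
  funext s
  simp only [siteOp_mulVec, Function.update_self, Function.update_idem, Matrix.mul_apply,
    Finset.mul_sum, Finset.sum_mul]
  rw [Finset.sum_comm]
  refine Finset.sum_congr rfl fun a _ => Finset.sum_congr rfl fun b _ => ?_
  ring

theorem siteOp_add {N : ℕ} (n : Fin N) (A B : Matrix (Fin 2) (Fin 2) ℂ) :
    siteOp n (A + B) = siteOp n A + siteOp n B := by
  ext s t
  simp only [siteOp, Matrix.add_apply, Matrix.of_apply]
  split_ifs <;> simp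

theorem siteOp_smul {N : ℕ} (n : Fin N) (c : ℂ) (A : Matrix (Fin 2) (Fin 2) ℂ) :
    siteOp n (c • A) = c • siteOp n A := by
  ext s t
  simp only [siteOp, Matrix.smul_apply, Matrix.of_apply, smul_eq_mul]
  split_ifs <;> simp

/-! ### Lax operators and the RTT relation of the bulk monodromy matrix. -/

/-- The Lax operator of site `n` in the bulk monodromy matrix `M(l)`. -/
noncomputable def lax {N : ℕ} (η : ℂ) (ξ : Fin N → ℂ) (l : ℂ) (n : Fin N) : AuxOp N :=
  R0 (-η) n (l - ξ n + η / 2)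

/-- The order of the sites in the bulk monodromy matrix `M(l)`. -/
def siteList (N : ℕ) : List (Fin N) := List.ofFn Fin.rev

theorem siteList_nodup (N : ℕ) : (siteList N).Nodup :=
  List.nodup_ofFn.2 Fin.rev_injective

theorem siteList_reverse (N : ℕ) : (siteList N).reverse = List.ofFn id := by
  refine List.ext_getElem (by simp [siteList]) fun i h1 h2 => ?_
  simp [siteList, Fin.ext_iff] at h1 ⊢
  omega

theorem bulkM_eq {N : ℕ} (η : ℂ) (ξ : Fin N → ℂ) (l : ℂ) :
    bulkM η ξ l = ((siteList N).map (lax η ξ l)).prod := by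
  rw [siteList, List.map_ofFn]; rfl

/-- Intertwining relation of two matrices of operators with the matrix `R̄(u)`. -/
def RTT {N : ℕ} (η u : ℂ) (X Y : AuxOp N) : Prop :=
  ∀ i j k l, ∑ a, ∑ b, Rmat (-η) u (i, j) (a, b) • (X a k * Y b l) =
    ∑ a, ∑ b, Rmat (-η) u (a, b) (k, l) • (Y j b * X i a)

theorem lax_commute {N : ℕ} (η : ℂ) (ξ : Fin N → ℂ) (l m : ℂ) {n n' : Fin N} (h : n ≠ n')
    (i j k k' : Fin 2) : Commute (lax η ξ l n i j) (lax η ξ m n' k k') :=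
  siteOp_commute h _ _

theorem commute_prod {N : ℕ} (x : Op N) (L : List (AuxOp N))
    (h : ∀ X ∈ L, ∀ i j, Commute x (X i j)) (i j : Fin 2) : Commute x (L.prod i j) := by
  induction L generalizing i j with
  | nil =>
    rw [List.prod_nil, Matrix.one_apply]
    split_ifs
    · exact Commute.one_right _
    · exact Commute.zero_right _
  | cons Y L ih =>
    rw [List.prod_cons, Matrix.mul_apply]
    exact Commute.sum_right _ _ _ fun a _ => (h Y (by simp) i a).mul_right
      (ih (fun X hX => h X (by simp [hX])) a j)

/-- The train argument: commutation across the two factors regroups `(X X')(Y Y')` as `(X Y)(X'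
Y')`, so `R̄` passes the first pair and then the second. -/
theorem RTT.mul {N : ℕ} {η u : ℂ} {X Y X' Y' : AuxOp N} (h : RTT η u X Y) (h' : RTT η u X' Y')
    (hc : ∀ i j k l, Commute (X' i j) (Y k l)) (hc' : ∀ i j k l, Commute (Y' i j) (X k l)) :
    RTT η u (X * X') (Y * Y') := by
  intro i j k l
  have e1 : ∀ a b, (X * X') a k * (Y * Y') b l =
      ∑ c, ∑ d, (X a c * Y b d) * (X' c k * Y' d l) := by
    intro a b
    simp only [Matrix.mul_apply, Finset.sum_mul, Finset.mul_sum]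
    rw [Finset.sum_comm]
    refine Finset.sum_congr rfl fun c _ => Finset.sum_congr rfl fun d _ => ?_
    rw [mul_assoc, mul_assoc, ← mul_assoc (Y _ _), ← (hc _ _ _ _).eq, mul_assoc]
  have e2 : ∀ a b, (Y * Y') j b * (X * X') i a =
      ∑ c, ∑ d, (Y j d * X i c) * (Y' d b * X' c a) := by
    intro a b
    simp only [Matrix.mul_apply, Finset.sum_mul, Finset.mul_sum]
    refine Finset.sum_congr rfl fun c _ => Finset.sum_congr rfl fun d _ => ?_
    rw [mul_assoc, mul_assoc, ← mul_assoc (X _ _), ← (hc' _ _ _ _).eq, mul_assoc]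
  simp only [e1, e2]
  calc _ = ∑ c, ∑ d, (∑ a, ∑ b, Rmat (-η) u (i, j) (a, b) • (X a c * Y b d)) *
        (X' c k * Y' d l) := by
        simp only [Fin.sum_univ_two, add_mul, smul_add, smul_mul_assoc]
        abel
    _ = ∑ c, ∑ d, (Y j d * X i c) *
        ∑ a, ∑ b, Rmat (-η) u (c, d) (a, b) • (X' a k * Y' b l) := by
        simp only [h i j]
        simp only [Fin.sum_univ_two, add_mul, mul_add, smul_mul_assoc, mul_smul_comm]
        abel
    _ = _ := by
        simp only [h' _ _ k l]
        simp only [Fin.sum_univ_two, mul_add, smul_add, mul_smul_comm]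
        abel

theorem siteOp_smul_sum {N : ℕ} (n : Fin N) (c : Fin 2 → Fin 2 → ℂ)
    (A : Fin 2 → Fin 2 → Matrix (Fin 2) (Fin 2) ℂ) :
    ∑ a, ∑ b, c a b • siteOp n (A a b) = siteOp n (∑ a, ∑ b, c a b • A a b) := by
  simp only [Fin.sum_univ_two, siteOp_add, siteOp_smul]

/-- The matrix entries of `R̄` in the auxiliary space. -/
noncomputable def Rblock (η l : ℂ) (i j : Fin 2) : Matrix (Fin 2) (Fin 2) ℂ :=
  Matrix.of fun a b => Rmat η l (i, a) (j, b)

theorem lax_apply {N : ℕ} (η : ℂ) (ξ : Fin N → ℂ) (l : ℂ) (n : Fin N) (i j : Fin 2) :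
    lax η ξ l n i j = siteOp n (Rblock (-η) (l - ξ n + η / 2) i j) := rfl

theorem Rblock_zero_zero (η l : ℂ) :
    Rblock η l 0 0 = !![Complex.sinh (l + η), 0; 0, Complex.sinh l] := by
  ext a b; fin_cases a <;> fin_cases b <;> simp [Rblock, Rmat]

theorem Rblock_zero_one (η l : ℂ) :
    Rblock η l 0 1 = !![0, 0; Complex.sinh η, 0] := by
  ext a b; fin_cases a <;> fin_cases b <;> simp [Rblock, Rmat]

theorem Rblock_one_zero (η l : ℂ) :
    Rblock η l 1 0 = !![0, Complex.sinh η; 0, 0] := by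
  ext a b; fin_cases a <;> fin_cases b <;> simp [Rblock, Rmat]

theorem Rblock_one_one (η l : ℂ) :
    Rblock η l 1 1 = !![Complex.sinh l, 0; 0, Complex.sinh (l + η)] := by
  ext a b; fin_cases a <;> fin_cases b <;> simp [Rblock, Rmat]

theorem Rmat_sum_left (η u : ℂ) (i j : Fin 2) {V : Type*} [AddCommGroup V] [Module ℂ V]
    (f : Fin 2 → Fin 2 → V) :
    ∑ a, ∑ b, Rmat η u (i, j) (a, b) • f a b =
      if i = j then Complex.sinh (u + η) • f i j
      else Complex.sinh u • f i j + Complex.sinh η • f j i := by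
  fin_cases i <;> fin_cases j <;> simp [Rmat, Fin.sum_univ_two, add_comm]

theorem Rmat_sum_right (η u : ℂ) (k l : Fin 2) {V : Type*} [AddCommGroup V] [Module ℂ V]
    (f : Fin 2 → Fin 2 → V) :
    ∑ a, ∑ b, Rmat η u (a, b) (k, l) • f a b =
      if k = l then Complex.sinh (u + η) • f k l
      else Complex.sinh u • f k l + Complex.sinh η • f l k := by
  fin_cases k <;> fin_cases l <;> simp [Rmat, Fin.sum_univ_two, add_comm]

/-- The Yang–Baxter equation with the quantum site as third space. Written in exponentials, each
entry is a rational identity. -/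
theorem Rblock_intertwine (η s t : ℂ) (i j k l : Fin 2) :
    ∑ a, ∑ b, Rmat η (s - t) (i, j) (a, b) • (Rblock η s a k * Rblock η t b l) =
      ∑ a, ∑ b, Rmat η (s - t) (a, b) (k, l) • (Rblock η t j b * Rblock η s i a) := by
  rw [Rmat_sum_left, Rmat_sum_right]
  have hs := Complex.exp_ne_zero s
  have ht := Complex.exp_ne_zero t
  have hη := Complex.exp_ne_zero η
  fin_cases i <;> fin_cases j <;> fin_cases k <;> fin_cases l <;> ext a b <;>
    fin_cases a <;> fin_cases b <;>
    simp [Rblock_zero_zero, Rblock_zero_one, Rblock_one_zero, Rblock_one_one,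
      -mul_eq_mul_left_iff, -mul_eq_mul_right_iff] <;>
    simp only [Complex.sinh, neg_add, neg_sub, Complex.exp_add, Complex.exp_sub,
      Complex.exp_neg] <;> field_simp <;> ring

theorem lax_RTT {N : ℕ} (η : ℂ) (ξ : Fin N → ℂ) (l m : ℂ) (n : Fin N) :
    RTT η (l - m) (lax η ξ l n) (lax η ξ m n) := by
  intro i j k p
  simp only [lax_apply, siteOp_mul, siteOp_smul_sum]
  congr 1
  have h := Rblock_intertwine (-η) (l - ξ n + η / 2) (m - ξ n + η / 2) i j k p
  rwa [show l - ξ n + η / 2 - (m - ξ n + η / 2) = l - m by ring] at h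

theorem RTT_one {N : ℕ} (η u : ℂ) : RTT η u (1 : AuxOp N) 1 := by
  intro i j k l
  rw [Rmat_sum_left, Rmat_sum_right]
  fin_cases i <;> fin_cases j <;> fin_cases k <;> fin_cases l <;> simp

theorem lax_prod_RTT {N : ℕ} (η : ℂ) (ξ : Fin N → ℂ) (l m : ℂ) (L : List (Fin N))
    (hL : L.Nodup) : RTT η (l - m) (L.map (lax η ξ l)).prod (L.map (lax η ξ m)).prod := by
  induction L with
  | nil => exact RTT_one _ _
  | cons n L ih =>
    rw [List.nodup_cons] at hL
    have hc : ∀ l m i j k p, Commute ((L.map (lax η ξ l)).prod i j) (lax η ξ m n k p) := by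
      intro l m i j k p
      refine (commute_prod _ _ (fun X hX i j => ?_) i j).symm
      obtain ⟨n', hn', rfl⟩ := List.mem_map.1 hX
      exact lax_commute _ _ _ _ (by rintro rfl; exact hL.1 hn') _ _ _ _
    exact (lax_RTT η ξ l m n).mul (ih hL.2) (hc _ _) (hc _ _)

theorem bulkM_RTT {N : ℕ} (η : ℂ) (ξ : Fin N → ℂ) (l m : ℂ) :
    RTT η (l - m) (bulkM η ξ l) (bulkM η ξ m) := by
  rw [bulkM_eq, bulkM_eq]
  exact lax_prod_RTT _ _ _ _ _ (siteList_nodup N)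

/-! ### Crossing: both halves of the boundary monodromy in terms of `M`. -/

/-- The adjugate of a `2 × 2` matrix of operators. -/
def crossing {N : ℕ} (X : AuxOp N) : AuxOp N := !![X 1 1, -X 0 1; -X 1 0, X 0 0]

/-- The usual rule for adjugates survives because only entries of different factors have to be
interchanged; the entries of `X` need not commute among themselves. The reversal of order turns the
site order of `M` into that of `T`. -/
theorem crossing_mul {N : ℕ} (X Y : AuxOp N) (h : ∀ i j k l, Commute (X i j) (Y k l)) :
    crossing (X * Y) = crossing Y * crossing X := by
  ext1 i j
  fin_cases i <;> fin_cases j <;>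
    simp [crossing, Matrix.mul_apply, Fin.sum_univ_two, (h _ _ _ _).eq] <;> abel

theorem crossing_prod {N : ℕ} (η : ℂ) (ξ : Fin N → ℂ) (l : ℂ) (L : List (Fin N))
    (hL : L.Nodup) : crossing (L.map (lax η ξ l)).prod =
      (L.reverse.map fun n => crossing (lax η ξ l n)).prod := by
  induction L with
  | nil =>
    ext1 i j
    fin_cases i <;> fin_cases j <;> simp [crossing]
  | cons n L ih =>
    rw [List.nodup_cons] at hL
    rw [List.map_cons, List.prod_cons, crossing_mul, ih hL.2, List.reverse_cons, List.map_append,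
      List.prod_append, List.map_singleton, List.prod_singleton]
    intro i j k p
    refine commute_prod _ _ (fun X hX k p => ?_) k p
    obtain ⟨n', hn', rfl⟩ := List.mem_map.1 hX
    exact lax_commute _ _ _ _ (by rintro rfl; exact hL.1 hn') _ _ _ _

theorem siteOp_neg {N : ℕ} (n : Fin N) (A : Matrix (Fin 2) (Fin 2) ℂ) :
    siteOp n (-A) = -siteOp n A := by
  rw [← neg_one_smul ℂ A, siteOp_smul, neg_one_smul]

/-- Crossing symmetry of the 6-vertex matrix: the adjugate swaps the diagonal blocks, which amounts
to a shift of the argument by `η`, and changes the sign of `sinh (-η)` off the diagonal. -/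
theorem crossing_lax {N : ℕ} (η : ℂ) (ξ : Fin N → ℂ) (l : ℂ) (n : Fin N) :
    crossing (lax η ξ l n) = R0 η n (l - ξ n - η / 2) := by
  have e : ∀ i j, R0 η n (l - ξ n - η / 2) i j = siteOp n (Rblock η (l - ξ n - η / 2) i j) :=
    fun _ _ => rfl
  have h1 : l - ξ n + η / 2 + -η = l - ξ n - η / 2 := by ring
  have h2 : l - ξ n - η / 2 + η = l - ξ n + η / 2 := by ring
  ext1 i j
  rw [e]
  fin_cases i <;> fin_cases j <;>
    simp [crossing, lax_apply, Rblock_zero_zero, Rblock_zero_one, Rblock_one_zero,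
      Rblock_one_one, h1, h2, ← siteOp_neg]

theorem monodromyT_eq {N : ℕ} (η : ℂ) (ξ : Fin N → ℂ) (l : ℂ) :
    monodromyT η ξ l = crossing (bulkM η ξ l) := by
  rw [bulkM_eq, crossing_prod _ _ _ _ (siteList_nodup N), siteList_reverse, List.map_ofFn]
  simp only [crossing_lax]
  rfl

theorem R0_neg {N : ℕ} (η : ℂ) (n : Fin N) (l : ℂ) : R0 η n l = -R0 (-η) n (-l) := by
  have e : ∀ η l i j, R0 η n l i j = siteOp n (Rblock η l i j) := fun _ _ _ _ => rfl
  have h : Complex.sinh (-l + -η) = -Complex.sinh (l + η) := by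
    rw [← Complex.sinh_neg]; ring_nf
  ext1 i j
  rw [Matrix.neg_apply, e, e, ← siteOp_neg]
  congr 1
  fin_cases i <;> fin_cases j <;>
    simp [Rblock_zero_zero, Rblock_zero_one, Rblock_one_zero, Rblock_one_one, h, Complex.sinh_neg]

theorem monodromyThat_eq {N : ℕ} (η : ℂ) (ξ : Fin N → ℂ) (l : ℂ) :
    monodromyThat η ξ l = ((-1) ^ N : ℂ) • bulkM η ξ (-l) := by
  have h : ∀ L : List (Fin N), (L.map fun n => R0 η n (l + ξ n - η / 2)).prod =
      ((-1) ^ L.length : ℂ) • (L.map (lax η ξ (-l))).prod := by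
    intro L
    induction L with
    | nil => simp
    | cons n L ih =>
      rw [List.map_cons, List.prod_cons, ih, List.map_cons, List.prod_cons, List.length_cons,
        R0_neg, show -(l + ξ n - η / 2) = -l - ξ n + η / 2 by ring, pow_succ, mul_neg_one,
        neg_smul, mul_smul_comm, neg_mul, smul_neg]
      rfl
  have h' := h (siteList N)
  rw [← bulkM_eq, siteList, List.length_ofFn, List.map_ofFn] at h'
  exact h'

/-! ### Gauge vectors and exchange relations of the operators `B`. -/

/-- The component `e^{-η/2 - l - ηx}` of the gauge vectors. -/
noncomputable def gaugePt (η l x : ℂ) : ℂ := Complex.exp (-η / 2 - l - η * x)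

/-- The gauge covector `(1, -e^{-η/2 - l - ηx})`. -/
noncomputable def gaugeCov (η l x : ℂ) : Fin 2 → ℂ := ![1, -gaugePt η l x]

/-- The gauge vector `(e^{-η/2 - l - ηy}, 1)`. -/
noncomputable def gaugeVec (η l y : ℂ) : Fin 2 → ℂ := ![gaugePt η l y, 1]

/-- The product of two matrices of operators, contracted with a vector of each auxiliary space. -/
noncomputable def pairEntry {N : ℕ} (X Y : AuxOp N) (P Q : Fin 2 → Fin 2 → ℂ) : Op N :=
  ∑ i, ∑ j, ∑ k, ∑ l, (P i j * Q k l) • (X i k * Y j l)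

theorem bulkB_eq_sum {N : ℕ} (η : ℂ) (ξ : Fin N → ℂ) (l x y : ℂ) :
    bulkB η ξ l x y = (-Complex.exp l) •
      ∑ i, ∑ k, (gaugeCov η l x i * gaugeVec η l y k) • bulkM η ξ l i k := by
  have h : ∀ x, -η / 2 - l + η * (0 - x) = -η / 2 - l - η * x := fun x => by ring
  rw [bulkB, aux_entry]
  congr 1
  simp only [Smat, h, Matrix.adjugate_fin_two_of, gaugeCov, gaugeVec, gaugePt, Fin.sum_univ_two,
    Matrix.of_apply, Matrix.cons_val_zero, Matrix.cons_val_one, Matrix.cons_val']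
  module

theorem bulkB_mul_bulkB {N : ℕ} (η : ℂ) (ξ : Fin N → ℂ) (l m x x' y y' : ℂ) :
    bulkB η ξ l x y * bulkB η ξ m x' y' = Complex.exp (l + m) •
      pairEntry (bulkM η ξ l) (bulkM η ξ m) (fun i j => gaugeCov η l x i * gaugeCov η m x' j)
        (fun i j => gaugeVec η l y i * gaugeVec η m y' j) := by
  rw [bulkB_eq_sum, bulkB_eq_sum, pairEntry, smul_mul_smul_comm, Complex.exp_add]
  congr 1
  · ring
  · simp only [Fin.sum_univ_two, add_mul, mul_add, smul_mul_assoc, mul_smul_comm]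
    module

theorem RTT.pairEntry_comm {N : ℕ} {η u : ℂ} {X Y : AuxOp N} (h : RTT η u X Y)
    (P Q : Fin 2 → Fin 2 → ℂ) :
    pairEntry X Y (fun a b => ∑ i, ∑ j, Rmat (-η) u (i, j) (a, b) * P i j) Q =
      pairEntry Y X (fun j i => P i j)
        (fun b a => ∑ k, ∑ l, Rmat (-η) u (a, b) (k, l) * Q k l) := by
  calc _ = ∑ i, ∑ j, ∑ k, ∑ l, (P i j * Q k l) •
        ∑ a, ∑ b, Rmat (-η) u (i, j) (a, b) • (X a k * Y b l) := by
        simp only [pairEntry, Fin.sum_univ_two]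
        module
    _ = _ := by
        simp only [h _ _ _ _]
        simp only [pairEntry, Fin.sum_univ_two]
        module

/-- The action of `R̄` on a pair of gauge vectors exchanges their heights. -/
theorem Rmat_gaugeVec (η l m y : ℂ) (a b : Fin 2) :
    ∑ k, ∑ j, Rmat (-η) (l - m) (a, b) (k, j) * (gaugeVec η l y k * gaugeVec η m (y + 1) j) =
      Complex.sinh (l - m - η) * (gaugeVec η l (y + 1) a * gaugeVec η m y b) := by
  have h := Rmat_sum_left (-η) (l - m) a b
    (fun k j => gaugeVec η l y k * gaugeVec η m (y + 1) j)
  simp only [smul_eq_mul] at h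
  rw [h]
  fin_cases a <;> fin_cases b <;>
    simp [gaugeVec, gaugePt, Complex.sinh, sub_eq_add_neg, mul_add, neg_div,
      -mul_eq_mul_left_iff, Complex.exp_add, Complex.exp_neg] <;> field_simp <;> ring

/-- The action of `R̄` on a pair of gauge covectors exchanges their heights. -/
theorem Rmat_gaugeCov (η l m x : ℂ) (a b : Fin 2) :
    ∑ i, ∑ j, Rmat (-η) (l - m) (i, j) (a, b) * (gaugeCov η l x i * gaugeCov η m (x + 1) j) =
      Complex.sinh (l - m - η) * (gaugeCov η l (x + 1) a * gaugeCov η m x b) := by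
  have h := Rmat_sum_right (-η) (l - m) a b
    (fun k j => gaugeCov η l x k * gaugeCov η m (x + 1) j)
  simp only [smul_eq_mul] at h
  rw [h]
  fin_cases a <;> fin_cases b <;>
    simp [gaugeCov, gaugePt, Complex.sinh, sub_eq_add_neg, mul_add, neg_div,
      -mul_eq_mul_left_iff, Complex.exp_add, Complex.exp_neg] <;> field_simp <;> ring

theorem pairEntry_smul_left {N : ℕ} (X Y : AuxOp N) (c : ℂ) (P Q : Fin 2 → Fin 2 → ℂ) :
    pairEntry X Y (fun i j => c * P i j) Q = c • pairEntry X Y P Q := by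
  simp only [pairEntry, Finset.smul_sum, smul_smul, mul_assoc]

theorem pairEntry_smul_right {N : ℕ} (X Y : AuxOp N) (c : ℂ) (P Q : Fin 2 → Fin 2 → ℂ) :
    pairEntry X Y P (fun i j => c * Q i j) = c • pairEntry X Y P Q := by
  simp only [pairEntry, Finset.smul_sum, smul_smul, mul_left_comm c]

theorem pairEntry_add_left {N : ℕ} (X Y : AuxOp N) (P P' Q : Fin 2 → Fin 2 → ℂ) :
    pairEntry X Y (fun i j => P i j + P' i j) Q = pairEntry X Y P Q + pairEntry X Y P' Q := by
  simp only [pairEntry, add_mul, add_smul, Finset.sum_add_distrib]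

/-- For consecutive heights `R̄` multiplies the covector pair and the vector pair by the same
scalar, which therefore appears on both sides of the contracted RTT relation. -/
theorem sinh_smul_bulkB_comm {N : ℕ} (η : ℂ) (ξ : Fin N → ℂ) (l m x y : ℂ) :
    Complex.sinh (l - m - η) • (bulkB η ξ l (x + 1) y * bulkB η ξ m x (y + 1)) =
      Complex.sinh (l - m - η) • (bulkB η ξ m (x + 1) y * bulkB η ξ l x (y + 1)) := by
  have h := (bulkM_RTT η ξ l m).pairEntry_comm
    (fun i j => gaugeCov η l x i * gaugeCov η m (x + 1) j)
    (fun i j => gaugeVec η l y i * gaugeVec η m (y + 1) j)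
  simp only [Rmat_gaugeCov, Rmat_gaugeVec] at h
  rw [pairEntry_smul_left, pairEntry_smul_right] at h
  rw [bulkB_mul_bulkB, bulkB_mul_bulkB, smul_comm, h, smul_comm, add_comm m l]
  simp only [mul_comm]

theorem continuous_list_prod_entry {N : ℕ} (η : ℂ) (ξ : Fin N → ℂ) (L : List (Fin N)) :
    Continuous fun l => (L.map (lax η ξ l)).prod := by
  have h : ∀ n, Continuous fun l => lax η ξ l n := by
    intro n
    refine continuous_matrix fun i j => continuous_matrix fun s t => ?_
    simp only [lax_apply, siteOp, Matrix.of_apply]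
    split_ifs
    · simp only [Rblock, Rmat, Matrix.of_apply]
      split_ifs <;> fun_prop
    · fun_prop
  induction L with
  | nil => simpa using continuous_const
  | cons n L ih =>
    simp only [List.map_cons, List.prod_cons]
    exact (h n).matrix_mul ih

theorem continuous_bulkB {N : ℕ} (η : ℂ) (ξ : Fin N → ℂ) (x y : ℂ) :
    Continuous fun l => bulkB η ξ l x y := by
  have h : ∀ i k, Continuous fun l => bulkM η ξ l i k := fun i k => by
    simp only [bulkM_eq]
    exact (continuous_list_prod_entry η ξ _).matrix_elem i k
  simp only [bulkB_eq_sum]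
  refine (by fun_prop : Continuous fun l : ℂ => -Complex.exp l).smul
    (continuous_finsetSum _ fun i _ => continuous_finsetSum _ fun k _ =>
      Continuous.smul (f := fun l => gaugeCov η l x i * gaugeVec η l y k) ?_ (h i k))
  fin_cases i <;> fin_cases k <;> simp [gaugeCov, gaugeVec, gaugePt] <;> fun_prop

/-- The scalar in `sinh_smul_bulkB_comm` has isolated zeros in `l`, and both sides are continuous in
`l`, so it can be cancelled everywhere. -/
theorem bulkB_comm {N : ℕ} (η : ℂ) (ξ : Fin N → ℂ) (l m x y : ℂ) :
    bulkB η ξ l (x + 1) y * bulkB η ξ m x (y + 1) =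
      bulkB η ξ m (x + 1) y * bulkB η ξ l x (y + 1) := by
  set f : ℂ → Op N := fun l => bulkB η ξ l (x + 1) y * bulkB η ξ m x (y + 1) -
      bulkB η ξ m (x + 1) y * bulkB η ξ l x (y + 1) with hf
  have hcont : Continuous f :=
    ((continuous_bulkB η ξ _ _).matrix_mul continuous_const).sub
      (continuous_const.matrix_mul (continuous_bulkB η ξ _ _))
  have hzero : ∀ l, Complex.sinh (l - m - η) ≠ 0 → f l = 0 := by
    intro l hl
    have h := sinh_smul_bulkB_comm η ξ l m x y
    exact sub_eq_zero.2 (smul_right_injective _ hl h)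
  suffices h : f l = 0 from sub_eq_zero.1 h
  by_cases hl : Complex.sinh (l - m - η) = 0
  -- A zero of `sinh` is simple because `cosh² = sinh² + 1`, so `sinh` is nonzero on a punctured
  -- neighbourhood.
  · have hd : HasDerivAt (fun l => Complex.sinh (l - m - η)) (Complex.cosh (l - m - η) * 1) l :=
      (((hasDerivAt_id l).sub_const m).sub_const η).csinh
    have hne : Complex.cosh (l - m - η) * 1 ≠ 0 := by
      intro h0
      have h1 := Complex.cosh_sq (l - m - η)
      rw [mul_one] at h0
      rw [h0, hl] at h1
      norm_num at h1
    have hev := hd.eventually_ne (c := 0) hne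
    have ht : Filter.Tendsto f (nhdsWithin l {l}ᶜ) (nhds (f l)) :=
      hcont.continuousAt.tendsto.mono_left nhdsWithin_le_nhds
    have ht' : Filter.Tendsto f (nhdsWithin l {l}ᶜ) (nhds 0) :=
      tendsto_const_nhds.congr' (hev.mono fun l hl => (hzero l hl).symm)
    exact tendsto_nhds_unique ht ht'
  · exact hzero l hl

/-- For heights that are not consecutive the covector pair is expanded in an `R̄`-image and a pair
with interchanged heights. Denominators are cleared, so no genericity is needed. -/
theorem sinh_mul_gaugeCov (η m n x x' : ℂ) (i j : Fin 2) :
    Complex.sinh (η * ((x' - x + 3) / 2)) * Complex.sinh (m - n) *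
        (gaugeCov η m x' i * gaugeCov η n x j) =
      Complex.sinh (η * ((x' - x + 1) / 2)) *
        ∑ a, ∑ b, Rmat (-η) (m - n) (a, b) (i, j) *
          (gaugeCov η m (x' + 1) a * gaugeCov η n (x - 1) b) +
      Complex.sinh η * Complex.sinh (m - n + η * ((x' - x + 1) / 2)) *
        (gaugeCov η m (x - 1) i * gaugeCov η n (x' + 1) j) := by
  have h := Rmat_sum_right (-η) (m - n) i j
    (fun k j => gaugeCov η m (x' + 1) k * gaugeCov η n (x - 1) j)
  simp only [smul_eq_mul] at h
  rw [h]
  -- With `z` the half-difference in the `sinh` factors, only integer multiples of `η z` and `η x`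
  -- occur.
  obtain ⟨z, rfl⟩ : ∃ z, x' = x + 2 * z - 1 := ⟨(x' - x + 1) / 2, by ring⟩
  have e1 : η * ((x + 2 * z - 1 - x + 3) / 2) = η * z + η := by ring
  have e2 : η * ((x + 2 * z - 1 - x + 1) / 2) = η * z := by ring
  have e3 : η * (x + 2 * z - 1) = η * x + (η * z + η * z) - η := by ring
  have e4 : η * (x + 2 * z - 1 + 1) = η * x + (η * z + η * z) := by ring
  have e5 : η * (x - 1) = η * x - η := by ring
  fin_cases i <;> fin_cases j <;>
    simp only [gaugeCov, gaugePt, e1, e2, e3, e4, e5] <;>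
    generalize η * z = w <;> generalize η * x = v <;>
    simp [Complex.sinh, sub_eq_add_neg, neg_div,
      Complex.exp_add, Complex.exp_neg] <;> field_simp <;> ring

/-- In the first term of `sinh_mul_gaugeCov`, RTT moves `R̄` to the right gauge vectors; their
heights `y`, `y + 1` are consecutive, so it acts there by `sinh (m - n - η)`. -/
theorem bulkB_exchange {N : ℕ} (η : ℂ) (ξ : Fin N → ℂ) (m n x x' y : ℂ) :
    (Complex.sinh (η * ((x' - x + 3) / 2)) * Complex.sinh (m - n)) •
        (bulkB η ξ m x' y * bulkB η ξ n x (y + 1)) =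
      (Complex.sinh (η * ((x' - x + 1) / 2)) * Complex.sinh (m - n - η)) •
        (bulkB η ξ n (x - 1) y * bulkB η ξ m (x' + 1) (y + 1)) +
      (Complex.sinh η * Complex.sinh (m - n + η * ((x' - x + 1) / 2))) •
        (bulkB η ξ m (x - 1) y * bulkB η ξ n (x' + 1) (y + 1)) := by
  have h := (bulkM_RTT η ξ m n).pairEntry_comm
    (fun i j => gaugeCov η m (x' + 1) i * gaugeCov η n (x - 1) j)
    (fun i j => gaugeVec η m y i * gaugeVec η n (y + 1) j)
  simp only [Rmat_gaugeVec] at h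
  rw [pairEntry_smul_right] at h
  have h2 : pairEntry (bulkM η ξ n) (bulkM η ξ m)
      (fun j i => gaugeCov η m (x' + 1) i * gaugeCov η n (x - 1) j)
      (fun j i => gaugeVec η m (y + 1) i * gaugeVec η n y j) =
      pairEntry (bulkM η ξ n) (bulkM η ξ m)
      (fun i j => gaugeCov η n (x - 1) i * gaugeCov η m (x' + 1) j)
      (fun i j => gaugeVec η n y i * gaugeVec η m (y + 1) j) := by
    simp only [mul_comm]
  rw [h2] at h
  simp only [bulkB_mul_bulkB]
  rw [smul_comm, ← pairEntry_smul_left]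
  simp only [sinh_mul_gaugeCov]
  rw [pairEntry_add_left, pairEntry_smul_left, pairEntry_smul_left, h, add_comm n m]
  module

/-! ### Action of `B` on the reference state. -/

/-- The product state of the vectors `(e^{-W n η - ξₙ}, 1)ᵗ`. -/
noncomputable def gaugeState {N : ℕ} (η : ℂ) (ξ : Fin N → ℂ) (W : Fin N → ℂ) : State N :=
  fun s => ∏ n : Fin N, (![Complex.exp (-(W n) * η - ξ n), 1] : Fin 2 → ℂ) (s n)

theorem gaugeState_eq_mul_erase {N : ℕ} (η : ℂ) (ξ : Fin N → ℂ) (W : Fin N → ℂ) (n : Fin N)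
    (s : Fin N → Fin 2) :
    gaugeState η ξ W s = (![Complex.exp (-(W n) * η - ξ n), 1] : Fin 2 → ℂ) (s n) *
      ∏ m ∈ Finset.univ.erase n, (![Complex.exp (-(W m) * η - ξ m), 1] : Fin 2 → ℂ) (s m) :=
  (Finset.mul_prod_erase _ _ (Finset.mem_univ n)).symm

theorem gaugeState_update {N : ℕ} (η : ℂ) (ξ : Fin N → ℂ) (W : Fin N → ℂ) (n : Fin N) (w : ℂ)
    (s : Fin N → Fin 2) (a : Fin 2) :
    gaugeState η ξ (Function.update W n w) (Function.update s n a) =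
      (![Complex.exp (-w * η - ξ n), 1] : Fin 2 → ℂ) a *
      ∏ m ∈ Finset.univ.erase n, (![Complex.exp (-(W m) * η - ξ m), 1] : Fin 2 → ℂ) (s m) := by
  rw [gaugeState_eq_mul_erase _ _ _ n, Function.update_self, Function.update_self]
  congr 1
  refine Finset.prod_congr rfl fun m hm => ?_
  rw [Function.update_of_ne (Finset.ne_of_mem_erase hm),
    Function.update_of_ne (Finset.ne_of_mem_erase hm)]

/-- The local vacuum property: when the heights of covector and site vector agree, the Lax action
factorizes again, lowering one height and raising the other. -/
theorem Rblock_gaugeCov (η l w z : ℂ) (j b : Fin 2) :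
    ∑ i, gaugeCov η l w i * ∑ a, Rblock (-η) (l - z + η / 2) i j b a *
        (![Complex.exp (-w * η - z), 1] : Fin 2 → ℂ) a =
      Complex.sinh (l - z + η / 2) * gaugeCov η l (w - 1) j *
        (![Complex.exp (-(w + 1) * η - z), 1] : Fin 2 → ℂ) b := by
  have e : l - z + η / 2 + -η = l - z - η / 2 := by ring
  have e1 : -w * η = -(η * w) := by ring
  have e2 : -(w + 1) * η = -(η * w) - η / 2 - η / 2 := by ring
  have e3 : -η / 2 - l - η * (w - 1) = η / 2 - l - η * w := by ring
  have e4 : -η = - (η / 2) - η / 2 := by ring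
  have e5 : -η / 2 = -(η / 2) := by ring
  simp only [gaugeCov, gaugePt, e1, e2, e3]
  fin_cases j <;> fin_cases b <;>
    simp only [Fin.sum_univ_two, Fin.zero_eta, Fin.mk_one, Rblock_zero_zero, Rblock_zero_one,
      Rblock_one_zero, Rblock_one_one, e, e5] <;> rw [e4] <;>
    generalize η / 2 = h <;> generalize η * w = v <;>
    simp [Complex.sinh, sub_eq_add_neg, Complex.exp_add, Complex.exp_neg,
      -mul_eq_mul_left_iff, -mul_eq_mul_right_iff] <;> field_simp <;> ring

theorem lax_gaugeCov_mulVec {N : ℕ} (η : ℂ) (ξ : Fin N → ℂ) (l : ℂ) (n : Fin N)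
    (W : Fin N → ℂ) (j : Fin 2) :
    ∑ i, gaugeCov η l (W n) i • (lax η ξ l n i j) *ᵥ gaugeState η ξ W =
      (Complex.sinh (l - ξ n + η / 2) * gaugeCov η l (W n - 1) j) •
        gaugeState η ξ (Function.update W n (W n + 1)) := by
  funext s
  have h := Rblock_gaugeCov η l (W n) (ξ n) j (s n)
  have h1 := fun a => gaugeState_update η ξ W n (W n) s a
  have h2 := gaugeState_update η ξ W n (W n + 1) s (s n)
  rw [Function.update_eq_self] at h2
  simp only [Function.update_eq_self] at h1
  simp only [Finset.sum_apply, Pi.smul_apply, smul_eq_mul, lax_apply, siteOp_mulVec, h1, h2]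
  rw [← mul_assoc, ← h]
  simp only [Fin.sum_univ_two]
  ring

theorem lax_prod_commute {N : ℕ} (η : ℂ) (ξ : Fin N → ℂ) (l m : ℂ) (n : Fin N) (L : List (Fin N))
    (hn : n ∉ L) (i j k p : Fin 2) :
    Commute (lax η ξ l n i j) ((L.map (lax η ξ m)).prod k p) := by
  refine commute_prod _ _ (fun X hX k p => ?_) k p
  obtain ⟨n', hn', rfl⟩ := List.mem_map.1 hX
  exact lax_commute _ _ _ _ (by rintro rfl; exact hn hn') _ _ _ _

/-- The covector loses one unit of height at every site, so the site heights must decrease by one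
along `L` for the local step to apply throughout. -/
theorem lax_prod_gaugeCov_mulVec {N : ℕ} (η : ℂ) (ξ : Fin N → ℂ) (l w : ℂ) (L : List (Fin N))
    (hL : L.Nodup) (W : Fin N → ℂ) (hW : ∀ i (h : i < L.length), W L[i] = w - i) (j : Fin 2) :
    ∑ i, gaugeCov η l w i • ((L.map (lax η ξ l)).prod i j) *ᵥ gaugeState η ξ W =
      ((L.map fun n => Complex.sinh (l - ξ n + η / 2)).prod * gaugeCov η l (w - L.length) j) •
        gaugeState η ξ (fun n => if n ∈ L then W n + 1 else W n) := by
  induction L generalizing w W with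
  | nil => fin_cases j <;> simp [Fin.sum_univ_two, Matrix.one_apply]
  | cons n L ih =>
    rw [List.nodup_cons] at hL
    have hn : W n = w := by
      have := hW 0 (by simp)
      simpa only [List.getElem_cons_zero, Nat.cast_zero, sub_zero] using this
    have hW' : ∀ i (h : i < L.length), Function.update W n (W n + 1) L[i] = w - 1 - i := by
      intro i h
      rw [Function.update_of_ne (ne_of_mem_of_not_mem (List.getElem_mem h) hL.1)]
      have := hW (i + 1) (by simpa using h)
      simp only [List.getElem_cons_succ] at this
      rw [this]; push_cast; ring
    have ih' := ih (w - 1) hL.2 _ hW'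
    have hstate : (fun m => if m ∈ L then Function.update W n (W n + 1) m + 1 else
        Function.update W n (W n + 1) m) = fun m => if m ∈ n :: L then W m + 1 else W m := by
      funext m
      by_cases hm : m = n
      · subst hm; simp [hL.1]
      · simp [hm]
    have hlen : w - 1 - (L.length : ℂ) = w - ((n :: L).length : ℂ) := by
      push_cast [List.length_cons]; ring
    rw [hstate, hlen] at ih'
    have hstep := lax_gaugeCov_mulVec η ξ l n W
    rw [hn] at hstep
    calc _ = ∑ a, ((L.map (lax η ξ l)).prod a j) *ᵥ
          ∑ i, gaugeCov η l w i • (lax η ξ l n i a) *ᵥ gaugeState η ξ W := by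
          have hc : ∀ i a, (lax η ξ l n i a) * ((L.map (lax η ξ l)).prod a j) =
              ((L.map (lax η ξ l)).prod a j) * (lax η ξ l n i a) :=
            fun i a => (lax_prod_commute η ξ l l n L hL.1 _ _ _ _).eq
          simp only [List.map_cons, List.prod_cons, Matrix.mul_apply, hc, Fin.sum_univ_two,
            Matrix.add_mulVec, Matrix.mulVec_add, Matrix.mulVec_smul, Matrix.mulVec_mulVec,
            smul_add]
          abel
      _ = Complex.sinh (l - ξ n + η / 2) • ∑ a, gaugeCov η l (w - 1) a •
          ((L.map (lax η ξ l)).prod a j) *ᵥ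
            gaugeState η ξ (Function.update W n (w + 1)) := by
          simp only [hstep, Matrix.mulVec_smul, Finset.smul_sum, smul_smul]
      _ = _ := by
          rw [hn] at ih'
          rw [ih', smul_smul, List.map_cons, List.prod_cons, mul_assoc]

theorem refState_eq {N : ℕ} (η : ℂ) (ξ : Fin N → ℂ) (x : ℂ) :
    refState η ξ x = gaugeState η ξ fun n => ((n : ℕ) : ℂ) + 1 - N + x := rfl

theorem bulkB_mulVec_refState {N : ℕ} (η : ℂ) (ξ : Fin N → ℂ) (l w y : ℂ) :
    bulkB η ξ l w y *ᵥ refState η ξ w =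
      (2 * Complex.exp (-η / 2 - η * ((y + w - N) / 2)) * Complex.sinh (η * ((y - w + N) / 2)) *
        aFun η ξ l) • refState η ξ (w + 1) := by
  have h := lax_prod_gaugeCov_mulVec η ξ l w (siteList N) (siteList_nodup N)
    (fun n => ((n : ℕ) : ℂ) + 1 - N + w) (by
      intro i hi
      simp only [siteList, List.length_ofFn] at hi
      simp only [siteList, List.getElem_ofFn, Fin.val_rev]
      rw [Nat.cast_sub (by omega)]
      push_cast
      ring)
  have hlen : (siteList N).length = N := by simp [siteList]
  have hmem : ∀ n, n ∈ siteList N := fun n => by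
    simp only [siteList, List.mem_ofFn]
    exact ⟨n.rev, Fin.rev_rev n⟩
  have hprod : ((siteList N).map fun n => Complex.sinh (l - ξ n + η / 2)).prod = aFun η ξ l := by
    rw [siteList, List.map_ofFn, List.prod_ofFn, aFun]
    exact Fintype.prod_equiv Fin.revPerm _ _ fun n => rfl
  simp only [← bulkM_eq, hlen, hmem, if_true, hprod, ← refState_eq] at h
  have hstate : (gaugeState η ξ fun n : Fin N => ((n : ℕ) : ℂ) + 1 - N + w + 1) =
      refState η ξ (w + 1) := by
    rw [refState_eq]; congr 1; funext n; ring
  rw [hstate] at h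
  -- The covector leaves the chain at height `w - N`; its pairing with the gauge vector of height
  -- `y` is a difference of two exponentials, hence a `sinh`.
  have hc : 2 * Complex.exp (-η / 2 - η * ((y + w - N) / 2)) *
      Complex.sinh (η * ((y - w + N) / 2)) =
      -Complex.exp l * (gaugePt η l y - gaugePt η l (w - N)) := by
    have e1 : -η / 2 - η * ((y + w - N) / 2) + η * ((y - w + N) / 2) =
      l + (-η / 2 - l - η * (w - N)) := by ring
    have e2 : -η / 2 - η * ((y + w - N) / 2) + -(η * ((y - w + N) / 2)) =
      l + (-η / 2 - l - η * y) := by ring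
    rw [mul_comm 2, mul_assoc, Complex.two_sinh, mul_sub, ← Complex.exp_add, ← Complex.exp_add,
      e1, e2, gaugePt, gaugePt, Complex.exp_add, Complex.exp_add]
    ring
  rw [bulkB_eq_sum, hc, Matrix.smul_mulVec]
  have h0 := h 0
  have h1 := h 1
  simp only [Fin.sum_univ_two] at h0 h1
  simp only [Fin.sum_univ_two, Matrix.add_mulVec, Matrix.smul_mulVec, mul_smul]
  calc _ = -Complex.exp l • (gaugeVec η l y 0 • (gaugeCov η l w 0 • bulkM η ξ l 0 0 *ᵥ
        refState η ξ w + gaugeCov η l w 1 • bulkM η ξ l 1 0 *ᵥ refState η ξ w) +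
        gaugeVec η l y 1 • (gaugeCov η l w 0 • bulkM η ξ l 0 1 *ᵥ
        refState η ξ w + gaugeCov η l w 1 • bulkM η ξ l 1 1 *ᵥ refState η ξ w)) := by
        module
    _ = _ := by
        rw [h0, h1]
        simp only [gaugeVec, gaugeCov, Matrix.cons_val_zero, Matrix.cons_val_one]
        module

/-! ### The boundary operator as a sum of two products of bulk operators. -/

/-- The coefficients of the boundary operator with respect to the entries of `M(l)` and
`M(-l)`. -/
noncomputable def boundaryForm (η ς κ τ l : ℂ) : Matrix (Fin 2) (Fin 2) ℂ :=
  !![Kmat η ς κ τ l 1 0, Kmat η ς κ τ l 1 1; -Kmat η ς κ τ l 0 0, -Kmat η ς κ τ l 0 1]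

/-- Since `T(l)` is an adjugate, its left gauge covector becomes a right gauge vector of `M(l)`, of
height `z - 1` because of the shift by `η`. The two right heights are thus consecutive, and `K₋`
contracts the two left indices. -/
theorem boundaryBhat_eq_pairEntry {N : ℕ} (η : ℂ) (ξ : Fin N → ℂ) (ς κ τ l z : ℂ) :
    boundaryBhat η ξ ς κ τ l z = ((-1) ^ N * Complex.exp (η * z) / 2) •
      pairEntry (bulkM η ξ l) (bulkM η ξ (-l)) (fun i j => boundaryForm η ς κ τ l i j)
        (fun i j => gaugeVec η l (z - 1) i * gaugeVec η (-l) z j) := by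
  have e1 : η / 2 - l + η * (0 - z) = -η / 2 - l - η * (z - 1) := by ring
  have e2 : l - η / 2 + η * (0 - z) = -η / 2 - -l - η * z := by ring
  have h : ∀ i j, boundaryU η ξ ς κ τ l i j = ((-1) ^ N : ℂ) • ∑ a, ∑ b,
      Kmat η ς κ τ l a b • (crossing (bulkM η ξ l) i a * bulkM η ξ (-l) b j) := by
    intro i j
    rw [boundaryU, monodromyT_eq, monodromyThat_eq]
    simp only [auxScalar, Matrix.mul_apply, Fin.sum_univ_two, Matrix.map_apply,
      Matrix.smul_apply, Algebra.algebraMap_eq_smul_one, mul_smul_comm, mul_one, smul_mul_assoc,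
      add_mul]
    module
  rw [boundaryBhat, aux_entry]
  simp only [h, Smat, e1, e2, Matrix.adjugate_fin_two_of, pairEntry, boundaryForm, gaugeVec,
    gaugePt, crossing, Fin.sum_univ_two, Matrix.of_apply, Matrix.cons_val_zero,
    Matrix.cons_val_one, Matrix.cons_val', Matrix.cons_val_fin_one, neg_mul]
  module

theorem Kmat_form_aux (η ς κ τ l θ E : ℂ) (hE : E = 1 ∨ E = -1)
    (hs : Complex.exp ς = 2 * κ * E * Complex.sinh θ) (i j : Fin 2) :
    (!![κ * Complex.exp (-τ) * Complex.sinh (2 * l - η), Complex.sinh (ς - l + η / 2);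
        -Complex.sinh (l - η / 2 + ς), -(κ * Complex.exp τ * Complex.sinh (2 * l - η))] :
          Matrix (Fin 2) (Fin 2) ℂ) i j * (2 * Complex.cosh (η - θ) * Complex.sinh (2 * l)) =
      -E * Complex.exp (-τ) *
      ((κ * E * Complex.sinh (-(2 * l) - η + θ) - Complex.exp (-ς) / 2) *
          Complex.sinh (2 * l - η) *
          ((![1, E * Complex.exp (η / 2 - l + τ - θ)] : Fin 2 → ℂ) i *
            (![1, -E * Complex.exp (-η / 2 + l + τ + θ)] : Fin 2 → ℂ) j) -
        (κ * E * Complex.sinh (2 * l - η + θ) - Complex.exp (-ς) / 2) *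
          ∑ a, ∑ b, Rmat (-η) (2 * l) (a, b) (i, j) *
            ((![1, -E * Complex.exp (-η / 2 - l + τ + θ)] : Fin 2 → ℂ) a *
            (![1, E * Complex.exp (η / 2 + l + τ - θ)] : Fin 2 → ℂ) b)) := by
  have h := Rmat_sum_right (-η) (2 * l) i j
    (fun a b => (![1, -E * Complex.exp (-η / 2 - l + τ + θ)] : Fin 2 → ℂ) a *
            (![1, E * Complex.exp (η / 2 + l + τ - θ)] : Fin 2 → ℂ) b)
  simp only [smul_eq_mul] at h
  rw [h]
  obtain ⟨r, rfl⟩ : ∃ r, η = 2 * r := ⟨η / 2, by ring⟩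
  -- Once `e^ς` is eliminated, the identity holds with `e^{-ς}` as an independent variable, and is
  -- checked in that form.
  have hs' : Complex.exp ς = κ * E * (Complex.exp θ - (Complex.exp θ)⁻¹) := by
    rw [hs, Complex.sinh, Complex.exp_neg]; ring
  rcases hE with rfl | rfl <;>
  fin_cases i <;> fin_cases j <;>
    simp [Complex.sinh, Complex.cosh, sub_eq_add_neg, Complex.exp_add, Complex.exp_neg, two_mul,
      -mul_eq_mul_left_iff, -mul_eq_mul_right_iff] <;>
    generalize (Complex.exp ς)⁻¹ = u <;> (try simp only [hs']) <;> field_simp <;> ring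

theorem sgn_eq_or (s : ℤˣ) : sgn s = 1 ∨ sgn s = -1 := by
  rcases Int.units_eq_one_or s with rfl | rfl <;> simp [sgn]

theorem exp_varsigma {ς κ φ ψ : ℂ} (hκ : κ ≠ 0)
    (h₁ : Complex.sinh φ * Complex.cosh ψ = Complex.sinh ς / (2 * κ))
    (h₂ : Complex.cosh φ * Complex.sinh ψ = Complex.cosh ς / (2 * κ)) (ε : ℤˣ) :
    Complex.exp ς = 2 * κ * sgn ε * Complex.sinh (sgn ε * (φ + ψ)) := by
  have h : Complex.exp ς = 2 * κ * Complex.sinh (φ + ψ) := by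
    rw [Complex.sinh_add, h₁, h₂, ← Complex.sinh_add_cosh]; field_simp
  rcases sgn_eq_or ε with e | e <;> rw [e, h] <;> simp [Complex.sinh_add]
  ring

/-- Product-to-sum makes the boundary coefficient affine in one `sinh` of `2u`; the constant term
comes from `e^{-ς} = -2κ sinh(φ - ψ)` and does not depend on the sign. -/
theorem aBoundary_eq {ς κ φ ψ : ℂ} (hκ : κ ≠ 0)
    (h₁ : Complex.sinh φ * Complex.cosh ψ = Complex.sinh ς / (2 * κ))
    (h₂ : Complex.cosh φ * Complex.sinh ψ = Complex.cosh ς / (2 * κ)) (ε : ℤˣ) (η u : ℂ) :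
    aBoundary η (sgn ε * φ) (sgn ε * ψ) u =
      (κ * sgn ε * Complex.sinh (2 * u - η + sgn ε * (φ + ψ)) - Complex.exp (-ς) / 2) /
        Complex.sinh ς := by
  have hprod : ∀ a b : ℂ, Complex.sinh a * Complex.cosh b =
      (Complex.sinh (a + b) + Complex.sinh (a - b)) / 2 := fun a b => by
    rw [Complex.sinh_add, Complex.sinh_sub]; ring
  have h : Complex.exp (-ς) = -(2 * κ * Complex.sinh (φ - ψ)) := by
    rw [Complex.sinh_sub, h₁, h₂, ← Complex.cosh_sub_sinh]; field_simp; ring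
  have hd : Complex.sinh (sgn ε * φ) * Complex.cosh (sgn ε * ψ) =
      sgn ε * (Complex.sinh ς / (2 * κ)) := by
    rw [← h₁]
    rcases sgn_eq_or ε with e | e <;> rw [e] <;> simp
  have hn : Complex.sinh (u - η / 2 + sgn ε * φ) * Complex.cosh (u - η / 2 + sgn ε * ψ) =
      (Complex.sinh (2 * u - η + sgn ε * (φ + ψ)) + sgn ε * Complex.sinh (φ - ψ)) / 2 := by
    rw [hprod]
    congr 2
    · ring_nf
    · rcases sgn_eq_or ε with e | e <;> rw [e]
      · ring_nf
      · rw [neg_one_mul (Complex.sinh _), ← Complex.sinh_neg]; ring_nf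
  rw [aBoundary, hd, hn, h]
  rcases sgn_eq_or ε with e | e <;> rw [e] <;> field_simp <;> ring

/-- The gauge parameters enter only through these quantities, so no division by `η` ever occurs. -/
theorem gauge_exp {η τ γ δ θ : ℂ} (ε : ℤˣ)
    (hγ : η * γ = -τ + sgn ε * (Complex.I * Real.pi / 2))
    (hδ : η * δ = -θ - Complex.I * Real.pi / 2) :
    Complex.exp (η * γ) = sgn ε * Complex.I * Complex.exp (-τ) ∧
      Complex.exp (η * δ) = -Complex.I * Complex.exp (-θ) ∧
      Complex.sinh (η * (δ + 1)) = -Complex.I * Complex.cosh (η - θ) := by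
  have hI : Complex.exp (Complex.I * Real.pi / 2) = Complex.I := by
    rw [show Complex.I * (Real.pi : ℂ) / 2 = Real.pi / 2 * Complex.I by ring,
      Complex.exp_pi_div_two_mul_I]
  have hI' : Complex.exp (-(Complex.I * Real.pi / 2)) = -Complex.I := by
    rw [Complex.exp_neg, hI, Complex.inv_I]
  refine ⟨?_, ?_, ?_⟩
  · rw [hγ, Complex.exp_add]
    rcases sgn_eq_or ε with e | e <;> rw [e]
    · rw [one_mul, hI]; ring
    · rw [neg_one_mul, hI']; ring
  · rw [hδ, sub_eq_add_neg, Complex.exp_add, hI']; ring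
  · have e : η * (δ + 1) = (η - θ) + -(Complex.I * Real.pi / 2) := by
      rw [mul_add, hδ]; ring
    rw [e, Complex.sinh, Complex.cosh, neg_add, neg_neg, Complex.exp_add, Complex.exp_add, hI, hI']
    ring

theorem boundaryForm_eq {η ς κ τ φ ψ γ δ l : ℂ} (hς : Complex.sinh ς ≠ 0) (hκ : κ ≠ 0)
    (h₁ : Complex.sinh φ * Complex.cosh ψ = Complex.sinh ς / (2 * κ))
    (h₂ : Complex.cosh φ * Complex.sinh ψ = Complex.cosh ς / (2 * κ)) (ε : ℤˣ)
    (hγ : η * γ = -τ + sgn ε * (Complex.I * Real.pi / 2))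
    (hδ : η * δ = -sgn ε * (φ + ψ) - Complex.I * Real.pi / 2)
    (hden : Complex.sinh (η * (δ + 1)) ≠ 0) (hl : Complex.sinh (2 * l) ≠ 0) (i j : Fin 2) :
    boundaryForm η ς κ τ l i j =
      Complex.exp (η * γ) / (2 * Complex.sinh (η * (δ + 1)) * Complex.sinh (2 * l)) *
      (aBoundary η (sgn ε * φ) (sgn ε * ψ) (-l) * Complex.sinh (2 * l - η) *
          (gaugeCov η l (γ - δ - 1) i * gaugeCov η (-l) (γ + δ) j) +
        -aBoundary η (sgn ε * φ) (sgn ε * ψ) l *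
          ∑ a, ∑ b, Rmat (-η) (l - -l) (a, b) (i, j) *
            (gaugeCov η l (γ + δ) a * gaugeCov η (-l) (γ - δ - 1) b)) := by
  rw [neg_mul] at hδ
  obtain ⟨hG, hD, hS⟩ := gauge_exp ε hγ hδ
  have hE := sgn_eq_or ε
  have h := Kmat_form_aux η ς κ τ l (sgn ε * (φ + ψ)) (sgn ε) hE (exp_varsigma hκ h₁ h₂ ε) i j
  have hE2 : (sgn ε)⁻¹ = sgn ε := by rcases hE with e | e <;> rw [e] <;> norm_num
  have c1 : ∀ l, gaugeCov η l (γ - δ - 1) =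
      ![1, sgn ε * Complex.exp (η / 2 - l + τ - sgn ε * (φ + ψ))] := by
    intro l
    have e : -η / 2 - l - η * (γ - δ - 1) = (η / 2 - l) - η * γ + η * δ := by ring
    rw [gaugeCov, gaugePt, e, Complex.exp_add, Complex.exp_sub _ (η * γ), hG, hD, add_sub_assoc,
      sub_eq_add_neg τ, Complex.exp_add (η / 2 - l), Complex.exp_add τ, Complex.exp_neg τ]
    congr 2
    have hI := Complex.I_ne_zero
    have hτ := Complex.exp_ne_zero τ
    rcases hE with e | e <;> rw [e] <;> field_simp
  have c2 : ∀ l, gaugeCov η l (γ + δ) =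
      ![1, -sgn ε * Complex.exp (-η / 2 - l + τ + sgn ε * (φ + ψ))] := by
    intro l
    have e : -η / 2 - l - η * (γ + δ) = (-η / 2 - l) - η * γ - η * δ := by ring
    rw [gaugeCov, gaugePt, e, Complex.exp_sub, Complex.exp_sub _ (η * γ), hG, hD, add_assoc,
      Complex.exp_add (-η / 2 - l), Complex.exp_add τ, Complex.exp_neg τ, Complex.exp_neg (_ * _)]
    congr 2
    have hI := Complex.I_ne_zero
    have hτ := Complex.exp_ne_zero τ
    rcases hE with e | e <;> rw [e] <;> field_simp <;> simp
  have e1 : η / 2 - -l + τ - sgn ε * (φ + ψ) = η / 2 + l + τ - sgn ε * (φ + ψ) := by ring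
  have e2 : -η / 2 - -l + τ + sgn ε * (φ + ψ) = -η / 2 + l + τ + sgn ε * (φ + ψ) := by ring
  have e3 : l - -l = 2 * l := by ring
  have e4 : 2 * -l = -(2 * l) := by ring
  have hK : boundaryForm η ς κ τ l i j = (Complex.sinh ς)⁻¹ *
      (!![κ * Complex.exp (-τ) * Complex.sinh (2 * l - η), Complex.sinh (ς - l + η / 2);
        -Complex.sinh (l - η / 2 + ς), -(κ * Complex.exp τ * Complex.sinh (2 * l - η))] :
          Matrix (Fin 2) (Fin 2) ℂ) i j := by
    fin_cases i <;> fin_cases j <;> simp [boundaryForm, Kmat]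
  have hc : Complex.cosh (η - sgn ε * (φ + ψ)) ≠ 0 := by
    intro h0; rw [hS, h0, mul_zero] at hden; exact hden rfl
  rw [c1, c1, c2, c2, e1, e2, e3, aBoundary_eq hκ h₁ h₂, aBoundary_eq hκ h₁ h₂, hG, hS, e4, hK]
  rw [← eq_div_iff (mul_ne_zero (mul_ne_zero two_ne_zero hc) hl)] at h
  rw [h]
  have hI := Complex.I_ne_zero
  generalize (∑ a, ∑ b, Rmat (-η) (2 * l) (a, b) (i, j) * _ : ℂ) = r
  field_simp
  ring

/-- In the second term of `boundaryForm_eq`, RTT transfers `R̄(2l)` to the right vectors, producing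
the missing factor `sinh (2l - η)` and interchanging `M(l)` with `M(-l)`. The two terms thus differ
by `l ↦ -l` and a sign. -/
theorem boundaryBhat_decomposition {N : ℕ} {η : ℂ} (ξ : Fin N → ℂ) {ς κ τ φ ψ γ δ l : ℂ}
    (hς : Complex.sinh ς ≠ 0) (hκ : κ ≠ 0)
    (h₁ : Complex.sinh φ * Complex.cosh ψ = Complex.sinh ς / (2 * κ))
    (h₂ : Complex.cosh φ * Complex.sinh ψ = Complex.cosh ς / (2 * κ)) (ε : ℤˣ)
    (hγ : η * γ = -τ + sgn ε * (Complex.I * Real.pi / 2))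
    (hδ : η * δ = -sgn ε * (φ + ψ) - Complex.I * Real.pi / 2)
    (hden : Complex.sinh (η * (δ + 1)) ≠ 0) (hl : Complex.sinh (2 * l) ≠ 0) (y : ℂ) :
    boundaryBhat η ξ ς κ τ l (y + 1) =
      ((-1) ^ N * Complex.exp (η * (y + 1 + γ)) / (4 * Complex.sinh (η * (δ + 1)))) •
      ∑ s : ℤˣ, (sgn s * aBoundary η (sgn ε * φ) (sgn ε * ψ) (-(sgn s * l)) *
        (Complex.sinh (2 * l - η) / Complex.sinh (2 * l))) •
          (bulkB η ξ (sgn s * l) (γ - δ - 1) y * bulkB η ξ (-(sgn s * l)) (γ + δ) (y + 1)) := by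
  have hR := (bulkM_RTT η ξ l (-l)).pairEntry_comm
    (fun i j => gaugeCov η l (γ + δ) i * gaugeCov η (-l) (γ - δ - 1) j)
    (fun i j => gaugeVec η l y i * gaugeVec η (-l) (y + 1) j)
  simp only [Rmat_gaugeVec] at hR
  rw [pairEntry_smul_right] at hR
  have hswap : pairEntry (bulkM η ξ (-l)) (bulkM η ξ l)
      (fun j i => gaugeCov η l (γ + δ) i * gaugeCov η (-l) (γ - δ - 1) j)
      (fun j i => gaugeVec η l (y + 1) i * gaugeVec η (-l) y j) =
      bulkB η ξ (-l) (γ - δ - 1) y * bulkB η ξ l (γ + δ) (y + 1) := by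
    rw [bulkB_mul_bulkB, neg_add_cancel, Complex.exp_zero, one_smul]
    simp only [mul_comm]
  have hdir : pairEntry (bulkM η ξ l) (bulkM η ξ (-l))
      (fun i j => gaugeCov η l (γ - δ - 1) i * gaugeCov η (-l) (γ + δ) j)
      (fun i j => gaugeVec η l y i * gaugeVec η (-l) (y + 1) j) =
      bulkB η ξ l (γ - δ - 1) y * bulkB η ξ (-l) (γ + δ) (y + 1) := by
    rw [bulkB_mul_bulkB, add_neg_cancel, Complex.exp_zero, one_smul]
  rw [hswap] at hR
  rw [boundaryBhat_eq_pairEntry, add_sub_cancel_right]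
  simp only [boundaryForm_eq hς hκ h₁ h₂ ε hγ hδ hden hl]
  rw [pairEntry_smul_left, pairEntry_add_left, pairEntry_smul_left, pairEntry_smul_left, hR, hdir]
  have hs : (Finset.univ : Finset ℤˣ) = {1, -1} := rfl
  have s1 : sgn 1 = 1 := by simp [sgn]
  have s2 : sgn (-1) = -1 := by simp [sgn]
  rw [hs, Finset.sum_pair (by decide), s1, s2]
  simp only [one_mul, neg_one_mul, neg_neg]
  rw [show l - -l - η = 2 * l - η by ring, mul_add η (y + 1) γ,
    Complex.exp_add]
  match_scalars <;> field_simp <;> ring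

/-! ### Products of operators `B`, independent of the order of the spectral parameters. -/

/-- `B(l₁ | x, y) B(l₂ | x - 1, y + 1) ⋯` for the list `[l₁, l₂, …]`. -/
noncomputable def bulkBList {N : ℕ} (η : ℂ) (ξ : Fin N → ℂ) : List ℂ → ℂ → ℂ → Op N
  | [], _, _ => 1
  | l :: L, x, y => bulkB η ξ l x y * bulkBList η ξ L (x - 1) (y + 1)

theorem bulkBList_perm {N : ℕ} (η : ℂ) (ξ : Fin N → ℂ) {L L' : List ℂ} (h : L.Perm L')
    (x y : ℂ) : bulkBList η ξ L x y = bulkBList η ξ L' x y := by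
  induction h generalizing x y with
  | nil => rfl
  | cons l _ ih => rw [bulkBList, bulkBList, ih]
  | swap l m L =>
    have h := bulkB_comm η ξ m l (x - 1) y
    rw [sub_add_cancel] at h
    simp only [bulkBList, ← mul_assoc, h]
  | trans _ _ ih ih' => rw [ih, ih']

theorem prod_ofFn_bulkB {N M : ℕ} (η : ℂ) (ξ : Fin N → ℂ) (g : Fin M → ℂ) (x y : ℂ) :
    (List.ofFn fun k : Fin M => bulkB η ξ (g k) (x - (k : ℕ)) (y + (k : ℕ))).prod =
      bulkBList η ξ (List.ofFn g) x y := by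
  induction M generalizing x y with
  | zero => simp [bulkBList]
  | succ M ih =>
    rw [List.ofFn_succ, List.ofFn_succ, List.prod_cons, bulkBList, ← ih]
    simp only [Fin.val_zero, Fin.val_succ, Nat.cast_zero, sub_zero, add_zero]
    refine congrArg (fun f => _ * (List.ofFn f).prod) (funext fun k => ?_)
    rw [Nat.cast_succ, show x - ((k : ℕ) + 1 : ℂ) = x - 1 - (k : ℕ) by ring,
      show y + ((k : ℕ) + 1 : ℂ) = y + 1 + (k : ℕ) by ring]

theorem bulkBProd_eq_bulkBList {N M : ℕ} (η : ℂ) (ξ : Fin N → ℂ) (μ : Fin M → ℂ) (x y : ℂ) :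
    bulkBProd η ξ μ x y = bulkBList η ξ (List.ofFn μ) (x - 1) y := by
  -- `bulkBProd` lists the parameters from last to first; reversal is a permutation, hence harmless.
  rw [← bulkBList_perm η ξ (Equiv.Perm.ofFn_comp_perm Fin.revPerm μ), ← prod_ofFn_bulkB, bulkBProd]
  refine congrArg (fun f => (List.ofFn f).prod) (funext fun k => ?_)
  rw [Function.comp, Fin.revPerm_apply, show x - ((k : ℕ) + 1 : ℂ) = x - 1 - (k : ℕ) by ring]

/-- The product of the operators `B` with the spectral parameters `ν i`, `i ∈ S`. -/
noncomputable def bulkBSet {N : ℕ} (η : ℂ) (ξ : Fin N → ℂ) {ι : Type*} (ν : ι → ℂ) (S : Finset ι)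
    (x y : ℂ) : Op N :=
  bulkBList η ξ (S.toList.map ν) x y

theorem bulkBSet_empty {N : ℕ} (η : ℂ) (ξ : Fin N → ℂ) {ι : Type*} (ν : ι → ℂ) (x y : ℂ) :
    bulkBSet η ξ ν ∅ x y = 1 := by
  simp [bulkBSet, bulkBList]

/-- The arbitrary order chosen by `Finset.toList` does not matter, so any element can be put first.
-/
theorem bulkBSet_insert {N : ℕ} (η : ℂ) (ξ : Fin N → ℂ) {ι : Type*} [DecidableEq ι] (ν : ι → ℂ)
    {S : Finset ι} {i : ι} (hi : i ∉ S) (x y : ℂ) :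
    bulkBSet η ξ ν (insert i S) x y = bulkB η ξ (ν i) x y * bulkBSet η ξ ν S (x - 1) (y + 1) := by
  rw [bulkBSet, bulkBList_perm η ξ ((Finset.toList_insert hi).map ν), List.map_cons, bulkBList]
  rfl

theorem bulkBSet_congr {N : ℕ} (η : ℂ) (ξ : Fin N → ℂ) {ι : Type*} {ν ν' : ι → ℂ}
    {S : Finset ι} (h : ∀ i ∈ S, ν i = ν' i) (x y : ℂ) :
    bulkBSet η ξ ν S x y = bulkBSet η ξ ν' S x y := by
  rw [bulkBSet, bulkBSet, List.map_congr_left fun i hi => h i (Finset.mem_toList.1 hi)]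

theorem bulkBProd_eq_bulkBSet {N M : ℕ} (η : ℂ) (ξ : Fin N → ℂ) (μ : Fin M → ℂ) (x y : ℂ) :
    bulkBProd η ξ μ x y = bulkBSet η ξ μ Finset.univ (x - 1) y := by
  rw [bulkBProd_eq_bulkBList, bulkBSet]
  refine bulkBList_perm η ξ ?_ _ _
  rw [List.ofFn_eq_map]
  refine List.Perm.map _ ((List.perm_ext_iff_of_nodup (List.nodup_finRange M)
    (Finset.nodup_toList _)).2 fun a => ?_)
  simp

theorem bulkBProd_succ {N M : ℕ} (η : ℂ) (ξ : Fin N → ℂ) (μ : Fin (M + 1) → ℂ) (x y : ℂ) :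
    bulkBProd η ξ μ x y =
      bulkB η ξ (μ 0) (x - 1) y * bulkBProd η ξ (fun k => μ k.succ) (x - 1) (y + 1) := by
  rw [bulkBProd_eq_bulkBList, bulkBProd_eq_bulkBList, List.ofFn_succ, bulkBList]

/-! ### Moving an operator `B` through a product onto the reference state. -/

/-- Merges the two contributions to one exchanged term in the induction of `bulkB_mulVec_bulkBSet`.
-/
theorem sinh_exchange_identity (η u v D : ℂ) :
    Complex.sinh D * Complex.sinh (u - η) * Complex.sinh (u + v + (D + η)) * Complex.sinh v +
      Complex.sinh (u + D) * Complex.sinh η * Complex.sinh (v + (D + η)) * Complex.sinh (u + v) =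
    Complex.sinh (D + η) * Complex.sinh u * Complex.sinh (u + v + D) * Complex.sinh (v + η) := by
  simp only [Complex.sinh, sub_eq_add_neg, neg_add, Complex.exp_add, Complex.exp_neg, neg_neg]
  field_simp
  ring

/-- The factor `sinh (u - η) / sinh u` of a direct exchange. -/
noncomputable def exFactor (η u : ℂ) : ℂ := Complex.sinh (u - η) / Complex.sinh u

/-- The scalar in the action of `B(l | w, y)` on the reference state `|η, w⟩`. -/
noncomputable def refFactor (N : ℕ) (η y w : ℂ) : ℂ :=
  2 * Complex.exp (-η / 2 - η * ((y + w - N) / 2)) * Complex.sinh (η * ((y - w + N) / 2))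

theorem refFactor_succ (N : ℕ) (η y w : ℂ) :
    refFactor N η (y + 1) (w + 1) = Complex.exp (-η) * refFactor N η y w := by
  have e1 : -η / 2 - η * ((y + 1 + (w + 1) - N) / 2) =
      -η + (-η / 2 - η * ((y + w - N) / 2)) := by ring
  rw [refFactor, refFactor, e1, Complex.exp_add, add_sub_add_right_eq_sub]
  ring

/-- Exchange `μ` with one `νᵢ`, then apply the induction hypothesis to both resulting products. Each
step sends `w`, `x`, `D` to `w + 1`, `x - 1`, `D + 1`, so `w + |S|` and `D + |S|` are preserved.
Every `j ≠ i` receives an exchanged term from both products; `j = i` and the direct term have one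
source each. -/
theorem bulkB_mulVec_bulkBSet {N : ℕ} (η : ℂ) (ξ : Fin N → ℂ) {ι : Type*} [DecidableEq ι]
    (ν : ι → ℂ) (S : Finset ι) (μ w x y D : ℂ) (hD : D = (w - x) / 2 + 1)
    (hμ : ∀ i ∈ S, Complex.sinh (μ - ν i) ≠ 0)
    (hν : ∀ i ∈ S, ∀ j ∈ S, i ≠ j → Complex.sinh (ν i - ν j) ≠ 0)
    (hden : ∀ j ∈ Finset.Icc 1 S.card, Complex.sinh (η * (D + (j : ℂ))) ≠ 0) :
    Complex.sinh (η * (D + S.card)) • (bulkB η ξ μ w y * bulkBSet η ξ ν S (x - 1) (y + 1)) *ᵥ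
        refState η ξ (w + S.card) =
      (Complex.exp (-(η * S.card)) * refFactor N η y w) •
      ((Complex.sinh (η * D) * aFun η ξ μ * ∏ k ∈ S, exFactor η (μ - ν k)) •
          bulkBSet η ξ ν S (x - 2) y *ᵥ refState η ξ (w + S.card + 1) +
        ∑ j ∈ S, (Complex.sinh η * (Complex.sinh (μ - ν j + η * D) / Complex.sinh (μ - ν j)) *
            aFun η ξ (ν j) * ∏ k ∈ S.erase j, exFactor η (ν j - ν k)) •
          (bulkB η ξ μ (x - 2) y * bulkBSet η ξ ν (S.erase j) (x - 3) (y + 1)) *ᵥ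
            refState η ξ (w + S.card + 1)) := by
  induction S using Finset.induction_on generalizing μ w x y D with
  | empty =>
    simp only [Finset.card_empty, Nat.cast_zero, add_zero, bulkBSet_empty, mul_one,
      bulkB_mulVec_refState, Finset.prod_empty, Finset.sum_empty, mul_zero, neg_zero,
      Complex.exp_zero, one_mul, Matrix.one_mulVec, refFactor]
    module
  | insert i S hi ih =>
    have hu : Complex.sinh (μ - ν i) ≠ 0 := hμ i (by simp)
    have hDne : Complex.sinh (η * (D + 1)) ≠ 0 := by simpa using hden 1 (by simp)
    have hD' : D + 1 = (w + 1 - (x - 1)) / 2 + 1 := by rw [hD]; ring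
    have hν' : ∀ i ∈ S, ∀ j ∈ S, i ≠ j → Complex.sinh (ν i - ν j) ≠ 0 :=
      fun a ha b hb => hν a (by simp [ha]) b (by simp [hb])
    have hden' : ∀ j ∈ Finset.Icc 1 S.card, Complex.sinh (η * (D + 1 + (j : ℂ))) ≠ 0 := by
      intro j hj
      rw [Finset.mem_Icc] at hj
      have := hden (j + 1) (by rw [Finset.card_insert_of_notMem hi, Finset.mem_Icc]; omega)
      push_cast at this
      rwa [add_assoc, add_comm (1 : ℂ)]
    have hiS : ∀ j ∈ S, i ≠ j := fun j hj h => hi (h ▸ hj)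
    have ih₁ := ih μ (w + 1) (x - 1) (y + 1) (D + 1) hD'
      (fun j hj => hμ j (by simp [hj])) hν' hden'
    have ih₂ := ih (ν i) (w + 1) (x - 1) (y + 1) (D + 1) hD'
      (fun j hj => hν i (by simp) j (by simp [hj]) (hiS j hj)) hν' hden'
    have hex := bulkB_exchange η ξ μ (ν i) (x - 1) w y
    rw [show (w - (x - 1) + 3) / 2 = D + 1 by rw [hD]; ring,
      show (w - (x - 1) + 1) / 2 = D by rw [hD]; ring, show x - 1 - 1 = x - 2 by ring] at hex
    rw [refFactor_succ, show x - 1 - 1 = x - 2 by ring, show x - 1 - 2 = x - 3 by ring,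
      show x - 1 - 3 = x - 4 by ring, show y + 1 + 1 = y + 2 by ring,
      show w + 1 + (S.card : ℂ) = w + (S.card + 1) by ring,
      show D + 1 + (S.card : ℂ) = D + (S.card + 1) by ring] at ih₁ ih₂
    rw [Finset.card_insert_of_notMem hi, Nat.cast_add, Nat.cast_one]
    have hexp : Complex.exp (-(η * ((S.card : ℂ) + 1))) =
        Complex.exp (-(η * S.card)) * Complex.exp (-η) := by
      rw [← Complex.exp_add]; ring_nf
    rw [hexp]
    generalize (S.card : ℂ) + 1 = n at ih₁ ih₂ ⊢
    generalize refState η ξ (w + n) = v₀ at ih₁ ih₂ ⊢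
    generalize refState η ξ (w + n + 1) = v at ih₁ ih₂ ⊢
    -- This is the scalar on the left of `bulkB_exchange`.
    refine smul_right_injective _ (mul_ne_zero hDne hu) ?_
    have herase : ∀ j ∈ S, bulkBSet η ξ ν ((insert i S).erase j) (x - 3) (y + 1) =
        bulkB η ξ (ν i) (x - 3) (y + 1) * bulkBSet η ξ ν (S.erase j) (x - 4) (y + 2) := by
      intro j hj
      rw [Finset.erase_insert_of_ne (hiS j hj),
        bulkBSet_insert _ _ _ (fun h => hi (Finset.mem_of_mem_erase h)),
        show x - 3 - 1 = x - 4 by ring, show y + 1 + 1 = y + 2 by ring]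
    have hcomm : bulkB η ξ (ν i) (x - 2) y * bulkB η ξ μ (x - 3) (y + 1) =
        bulkB η ξ μ (x - 2) y * bulkB η ξ (ν i) (x - 3) (y + 1) := by
      have h := bulkB_comm η ξ (ν i) μ (x - 3) y
      rwa [show x - 3 + 1 = x - 2 by ring] at h
    have hins : bulkBSet η ξ ν (insert i S) (x - 1) (y + 1) =
        bulkB η ξ (ν i) (x - 1) (y + 1) * bulkBSet η ξ ν S (x - 2) (y + 2) := by
      rw [bulkBSet_insert _ _ _ hi, show x - 1 - 1 = x - 2 by ring,
        show y + 1 + 1 = y + 2 by ring]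
    have hins' : bulkBSet η ξ ν (insert i S) (x - 2) y =
        bulkB η ξ (ν i) (x - 2) y * bulkBSet η ξ ν S (x - 3) (y + 1) := by
      rw [bulkBSet_insert _ _ _ hi, show x - 2 - 1 = x - 3 by ring]
    have hsum : ∀ j ∈ S, bulkB η ξ (ν i) (x - 2) y *ᵥ ((bulkB η ξ μ (x - 3) (y + 1) *
        bulkBSet η ξ ν (S.erase j) (x - 4) (y + 2)) *ᵥ v) = (bulkB η ξ μ (x - 2) y *
          bulkBSet η ξ ν ((insert i S).erase j) (x - 3) (y + 1)) *ᵥ v := by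
      intro j hj
      rw [herase j hj, Matrix.mulVec_mulVec, ← mul_assoc, hcomm, mul_assoc]
    have hsum' : ∀ j ∈ S, bulkB η ξ μ (x - 2) y *ᵥ ((bulkB η ξ (ν i) (x - 3) (y + 1) *
        bulkBSet η ξ ν (S.erase j) (x - 4) (y + 2)) *ᵥ v) = (bulkB η ξ μ (x - 2) y *
          bulkBSet η ξ ν ((insert i S).erase j) (x - 3) (y + 1)) *ᵥ v := by
      intro j hj
      rw [herase j hj, Matrix.mulVec_mulVec]
    have hprod : ∀ j ∈ S, ∏ k ∈ (insert i S).erase j, exFactor η (ν j - ν k) =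
        exFactor η (ν j - ν i) * ∏ k ∈ S.erase j, exFactor η (ν j - ν k) := by
      intro j hj
      rw [Finset.erase_insert_of_ne (hiS j hj),
        Finset.prod_insert (fun h => hi (Finset.mem_of_mem_erase h))]
    -- The two sources of the `j`-th exchanged term: `μ` exchanged directly with `νⱼ`, or `μ` with
    -- `νᵢ` and then `νᵢ` with `νⱼ`.
    have hcoef : ∀ j ∈ S,
        Complex.sinh (η * (D + 1)) * Complex.sinh (μ - ν i) *
          (Complex.sinh η * (Complex.sinh (μ - ν j + η * D) / Complex.sinh (μ - ν j)) *
            exFactor η (ν j - ν i)) =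
        Complex.sinh (η * D) * Complex.sinh (μ - ν i - η) *
          (Complex.sinh η * (Complex.sinh (μ - ν j + η * (D + 1)) / Complex.sinh (μ - ν j))) +
        Complex.sinh η * Complex.sinh (μ - ν i + η * D) *
          (Complex.sinh η * (Complex.sinh (ν i - ν j + η * (D + 1)) /
            Complex.sinh (ν i - ν j))) := by
      intro j hj
      have h1 : Complex.sinh (μ - ν j) ≠ 0 := hμ j (by simp [hj])
      have h2 : Complex.sinh (ν i - ν j) ≠ 0 := hν i (by simp) j (by simp [hj]) (hiS j hj)
      have h := sinh_exchange_identity η (μ - ν i) (ν i - ν j) (η * D)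
      rw [sub_add_sub_cancel] at h
      rw [exFactor, show ν j - ν i - η = -(ν i - ν j + η) by ring,
        show ν j - ν i = -(ν i - ν j) by ring, Complex.sinh_neg, Complex.sinh_neg,
        show η * (D + 1) = η * D + η by ring]
      generalize η * D = d at h ⊢
      field_simp
      linear_combination (-Complex.sinh η) * h
    change (Complex.sinh (η * (D + 1)) * Complex.sinh (μ - ν i)) • (_ : State N) =
      (Complex.sinh (η * (D + 1)) * Complex.sinh (μ - ν i)) • (_ : State N)
    calc _ = Complex.sinh (η * (D + n)) • ((Complex.sinh (η * (D + 1)) * Complex.sinh (μ - ν i)) •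
          (bulkB η ξ μ w y * bulkB η ξ (ν i) (x - 1) (y + 1))) *ᵥ
            (bulkBSet η ξ ν S (x - 2) (y + 2) *ᵥ v₀) := by
          rw [hins, ← mul_assoc, ← Matrix.mulVec_mulVec, Matrix.smul_mulVec, smul_comm]
      _ = (Complex.sinh (η * D) * Complex.sinh (μ - ν i - η)) • bulkB η ξ (ν i) (x - 2) y *ᵥ
            (Complex.sinh (η * (D + n)) • (bulkB η ξ μ (w + 1) (y + 1) *
              bulkBSet η ξ ν S (x - 2) (y + 2)) *ᵥ v₀) +
          (Complex.sinh η * Complex.sinh (μ - ν i + η * D)) • bulkB η ξ μ (x - 2) y *ᵥ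
            (Complex.sinh (η * (D + n)) • (bulkB η ξ (ν i) (w + 1) (y + 1) *
              bulkBSet η ξ ν S (x - 2) (y + 2)) *ᵥ v₀) := by
          rw [hex]
          simp only [Matrix.mulVec_smul, Matrix.smul_mulVec, Matrix.add_mulVec,
            ← Matrix.mulVec_mulVec]
          module
      _ = _ := by
          have e₁ : bulkB η ξ (ν i) (x - 2) y *ᵥ ∑ j ∈ S, (Complex.sinh η *
              (Complex.sinh (μ - ν j + η * (D + 1)) / Complex.sinh (μ - ν j)) * aFun η ξ (ν j) *
              ∏ k ∈ S.erase j, exFactor η (ν j - ν k)) • (bulkB η ξ μ (x - 3) (y + 1) *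
                bulkBSet η ξ ν (S.erase j) (x - 4) (y + 2)) *ᵥ v = ∑ j ∈ S, (Complex.sinh η *
              (Complex.sinh (μ - ν j + η * (D + 1)) / Complex.sinh (μ - ν j)) * aFun η ξ (ν j) *
              ∏ k ∈ S.erase j, exFactor η (ν j - ν k)) • (bulkB η ξ μ (x - 2) y *
                bulkBSet η ξ ν ((insert i S).erase j) (x - 3) (y + 1)) *ᵥ v := by
            rw [Matrix.mulVec_sum]
            refine Finset.sum_congr rfl fun j hj => ?_
            rw [Matrix.mulVec_smul, hsum j hj]
          have e₂ : bulkB η ξ μ (x - 2) y *ᵥ ∑ j ∈ S, (Complex.sinh η *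
              (Complex.sinh (ν i - ν j + η * (D + 1)) / Complex.sinh (ν i - ν j)) *
              aFun η ξ (ν j) * ∏ k ∈ S.erase j, exFactor η (ν j - ν k)) •
                (bulkB η ξ (ν i) (x - 3) (y + 1) *
                bulkBSet η ξ ν (S.erase j) (x - 4) (y + 2)) *ᵥ v = ∑ j ∈ S, (Complex.sinh η *
              (Complex.sinh (ν i - ν j + η * (D + 1)) / Complex.sinh (ν i - ν j)) *
              aFun η ξ (ν j) * ∏ k ∈ S.erase j, exFactor η (ν j - ν k)) •
              (bulkB η ξ μ (x - 2) y *
                bulkBSet η ξ ν ((insert i S).erase j) (x - 3) (y + 1)) *ᵥ v := by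
            rw [Matrix.mulVec_sum]
            refine Finset.sum_congr rfl fun j hj => ?_
            rw [Matrix.mulVec_smul, hsum' j hj]
          have e₃ : (Complex.sinh (η * (D + 1)) * Complex.sinh (μ - ν i)) • ∑ j ∈ S, (Complex.sinh η * (Complex.sinh (μ - ν j + η * D) /
              Complex.sinh (μ - ν j)) * aFun η ξ (ν j) *
              ∏ k ∈ (insert i S).erase j, exFactor η (ν j - ν k)) • (bulkB η ξ μ (x - 2) y *
                bulkBSet η ξ ν ((insert i S).erase j) (x - 3) (y + 1)) *ᵥ v =
              (Complex.sinh (η * D) * Complex.sinh (μ - ν i - η)) • ∑ j ∈ S, (Complex.sinh η *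
              (Complex.sinh (μ - ν j + η * (D + 1)) / Complex.sinh (μ - ν j)) * aFun η ξ (ν j) *
              ∏ k ∈ S.erase j, exFactor η (ν j - ν k)) • (bulkB η ξ μ (x - 2) y *
                bulkBSet η ξ ν ((insert i S).erase j) (x - 3) (y + 1)) *ᵥ v +
              (Complex.sinh η * Complex.sinh (μ - ν i + η * D)) • ∑ j ∈ S, (Complex.sinh η *
              (Complex.sinh (ν i - ν j + η * (D + 1)) / Complex.sinh (ν i - ν j)) *
              aFun η ξ (ν j) *
              ∏ k ∈ S.erase j, exFactor η (ν j - ν k)) • (bulkB η ξ μ (x - 2) y *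
                bulkBSet η ξ ν ((insert i S).erase j) (x - 3) (y + 1)) *ᵥ v := by
            rw [Finset.smul_sum, Finset.smul_sum, Finset.smul_sum, ← Finset.sum_add_distrib]
            refine Finset.sum_congr rfl fun j hj => ?_
            rw [smul_smul, smul_smul, smul_smul, ← add_smul, hprod j hj]
            congr 1
            linear_combination (aFun η ξ (ν j) * ∏ k ∈ S.erase j, exFactor η (ν j - ν k)) *
              hcoef j hj
          have hf : Complex.sinh (μ - ν i) * exFactor η (μ - ν i) = Complex.sinh (μ - ν i - η) :=
            mul_div_cancel₀ _ hu
          have hg : Complex.sinh (μ - ν i) * (Complex.sinh (μ - ν i + η * D) /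
              Complex.sinh (μ - ν i)) = Complex.sinh (μ - ν i + η * D) :=
            mul_div_cancel₀ _ hu
          rw [ih₁, ih₂, Matrix.mulVec_smul, Matrix.mulVec_smul, Matrix.mulVec_add,
            Matrix.mulVec_add, e₁, e₂, Finset.sum_insert hi, Finset.erase_insert hi,
            Finset.prod_insert hi, hins', Matrix.mulVec_smul, Matrix.mulVec_smul,
            Matrix.mulVec_mulVec, Matrix.mulVec_mulVec]
          have hf' := congrArg (fun c : ℂ => c • (bulkB η ξ (ν i) (x - 2) y *
            bulkBSet η ξ ν S (x - 3) (y + 1)) *ᵥ v) hf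
          have hg' := congrArg (fun c : ℂ => c • (bulkB η ξ μ (x - 2) y *
            bulkBSet η ξ ν S (x - 3) (y + 1)) *ᵥ v) hg
          generalize refFactor N η y w = r
          generalize (∏ k ∈ S, exFactor η (μ - ν k)) = p
          generalize (∏ k ∈ S, exFactor η (ν i - ν k)) = q
          linear_combination (norm := module)
            (-(Complex.exp (-(η * S.card)) * (Complex.exp (-η) * r))) • e₃ -
            (Complex.exp (-(η * S.card)) * Complex.exp (-η) * r * Complex.sinh (η * (D + 1)) *
              Complex.sinh (η * D) * aFun η ξ μ * p) • hf' -
            (Complex.exp (-(η * S.card)) * Complex.exp (-η) * r * Complex.sinh (η * (D + 1)) *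
              Complex.sinh η * aFun η ξ (ν i) * q) • hg'

/-! ### The four-term identity of the boundary coefficients. -/

theorem boundary_cancellation_aux (A C ω a b : ℂ) (h₁ : Complex.sinh (a + b) ≠ 0)
    (h₂ : Complex.sinh (a - b) ≠ 0) :
    (A * Complex.sinh (-(2 * a) - ω) + C) * (A * Complex.sinh (-(2 * b) - ω) + C) *
        (Complex.cosh (-(a + b) + ω) / Complex.sinh (-(a + b))) -
      (A * Complex.sinh (2 * a - ω) + C) * (A * Complex.sinh (-(2 * b) - ω) + C) *
        (Complex.cosh (a - b + ω) / Complex.sinh (a - b)) -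
      (A * Complex.sinh (-(2 * a) - ω) + C) * (A * Complex.sinh (2 * b - ω) + C) *
        (Complex.cosh (-(a - b) + ω) / Complex.sinh (-(a - b))) +
      (A * Complex.sinh (2 * a - ω) + C) * (A * Complex.sinh (2 * b - ω) + C) *
        (Complex.cosh (a + b + ω) / Complex.sinh (a + b)) = 0 := by
  -- In these variables the denominators are `sinh 2p` and `sinh 2q`; they are kept abstract until
  -- fractions are cleared.
  obtain ⟨p, q, rfl, rfl⟩ : ∃ p q, a = p + q ∧ b = p - q :=
    ⟨(a + b) / 2, (a - b) / 2, by ring, by ring⟩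
  rw [Complex.sinh_neg, Complex.sinh_neg]
  rw [show p + q + (p - q) = p + p by ring] at *
  rw [show p + q - (p - q) = q + q by ring] at *
  generalize hX : Complex.sinh (p + p) = X at *
  generalize hY : Complex.sinh (q + q) = Y at *
  field_simp
  rw [← hX, ← hY]
  rw [mul_add p, mul_add q, mul_one, mul_one]
  simp only [Complex.sinh, Complex.cosh, sub_eq_add_neg, neg_add, two_mul,
    Complex.exp_add,
    Complex.exp_neg, neg_neg]
  field_simp
  ring

theorem sinh_add_gauge {η δ θ : ℂ} (hδ : η * δ = -θ - Complex.I * Real.pi / 2) (u : ℂ) :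
    Complex.sinh (u + η * (δ + 1)) = -Complex.I * Complex.cosh (u + (η - θ)) := by
  have e : u + η * (δ + 1) = (u + (η - θ)) - Real.pi / 2 * Complex.I := by
    rw [mul_add, hδ]; ring
  rw [e, Complex.sinh_sub, Complex.sinh_mul_I, Complex.cosh_mul_I, Complex.cos_pi_div_two,
    Complex.sin_pi_div_two]
  ring

theorem boundary_cancellation {η ς κ φ ψ δ : ℂ} (hκ : κ ≠ 0)
    (h₁ : Complex.sinh φ * Complex.cosh ψ = Complex.sinh ς / (2 * κ))
    (h₂ : Complex.cosh φ * Complex.sinh ψ = Complex.cosh ς / (2 * κ)) (ε : ℤˣ)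
    (hδ : η * δ = -sgn ε * (φ + ψ) - Complex.I * Real.pi / 2) (a b : ℂ)
    (hab : Complex.sinh (a + b) ≠ 0) (hab' : Complex.sinh (a - b) ≠ 0) (P : ℂ → ℂ)
    (hP : ∀ u, P u = aBoundary η (sgn ε * φ) (sgn ε * ψ) u) :
    P (-a) * P (-b) *
        (Complex.sinh (-(a + b) + η * (δ + 1)) / Complex.sinh (-(a + b))) -
      P a * P (-b) * (Complex.sinh (a - b + η * (δ + 1)) / Complex.sinh (a - b)) -
      P (-a) * P b * (Complex.sinh (-(a - b) + η * (δ + 1)) / Complex.sinh (-(a - b))) +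
      P a * P b * (Complex.sinh (a + b + η * (δ + 1)) / Complex.sinh (a + b)) = 0 := by
  rw [neg_mul] at hδ
  have h := boundary_cancellation_aux (κ * sgn ε / Complex.sinh ς)
    (-(Complex.exp (-ς) / 2) / Complex.sinh ς) (η - sgn ε * (φ + ψ)) a b hab hab'
  have hP' : ∀ u, P u = κ * sgn ε / Complex.sinh ς *
      Complex.sinh (2 * u - (η - sgn ε * (φ + ψ))) + -(Complex.exp (-ς) / 2) / Complex.sinh ς := by
    intro u
    rw [hP, aBoundary_eq hκ h₁ h₂, show 2 * u - (η - sgn ε * (φ + ψ)) =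
      2 * u - η + sgn ε * (φ + ψ) by ring]
    ring
  simp only [sinh_add_gauge hδ, hP', mul_neg]
  linear_combination (-Complex.I) * h

/-! ### Recursions for the coefficients and cancellation of the exchanged terms. -/

/-- The factor of `Hcoeff` attached to a single spectral parameter. -/
noncomputable def siteFactor {N : ℕ} (η : ℂ) (ξ : Fin N → ℂ) (φ ψ : ℂ) (s : ℤˣ) (l : ℂ) : ℂ :=
  sgn s * aFun η ξ (-(sgn s * l)) * aBoundary η φ ψ (-(sgn s * l)) *
    (Complex.sinh (2 * l - η) / Complex.sinh (2 * l))

/-- The factor of `Hcoeff` attached to a pair of signed spectral parameters. -/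
noncomputable def pairFactor (η a b : ℂ) : ℂ := Complex.sinh (a + b + η) / Complex.sinh (a + b)

theorem pairFactor_comm (η a b : ℂ) : pairFactor η a b = pairFactor η b a := by
  rw [pairFactor, pairFactor, add_comm a b]

theorem exFactor_neg_sub (η a b : ℂ) : exFactor η (-a - b) = pairFactor η a b := by
  rw [exFactor, pairFactor, show -a - b - η = -(a + b + η) by ring,
    show -a - b = -(a + b) by ring, Complex.sinh_neg, Complex.sinh_neg, neg_div_neg_eq]

theorem Hcoeff_eq {N M : ℕ} (η : ℂ) (ξ : Fin N → ℂ) (φ ψ : ℂ) (σ : Fin M → ℤˣ)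
    (lam : Fin M → ℂ) : Hcoeff η ξ φ ψ σ lam = (∏ n, siteFactor η ξ φ ψ (σ n) (lam n)) *
      ∏ a, ∏ b ∈ Finset.Ioi a, pairFactor η (sgn (σ a) * lam a) (sgn (σ b) * lam b) := rfl

theorem Hcoeff_cons {N M : ℕ} (η : ℂ) (ξ : Fin N → ℂ) (φ ψ : ℂ) (s : ℤˣ) (σ : Fin M → ℤˣ)
    (lam : Fin (M + 1) → ℂ) : Hcoeff η ξ φ ψ (Fin.cons s σ : Fin (M + 1) → ℤˣ) lam =
      siteFactor η ξ φ ψ s (lam 0) *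
        (∏ k, pairFactor η (sgn s * lam 0) (sgn (σ k) * lam k.succ)) *
        Hcoeff η ξ φ ψ σ (fun k => lam k.succ) := by
  rw [Hcoeff_eq, Hcoeff_eq, Fin.prod_univ_succ, Fin.prod_univ_succ]
  simp only [Fin.prod_Ioi_zero, Fin.prod_Ioi_succ, Fin.cons_zero, Fin.cons_succ]
  ring

theorem prod_prod_Ioi_eq_mul {M : ℕ} (F : Fin M → Fin M → ℂ) (hF : ∀ a b, F a b = F b a)
    (j : Fin M) : ∏ a, ∏ b ∈ Finset.Ioi a, F a b = (∏ k ∈ Finset.univ.erase j, F j k) *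
      ∏ a ∈ Finset.univ.erase j, ∏ b ∈ (Finset.Ioi a).erase j, F a b := by
  have h : ∀ a ∈ Finset.univ.erase j, ∏ b ∈ Finset.Ioi a, F a b =
      (if a < j then F j a else 1) * ∏ b ∈ (Finset.Ioi a).erase j, F a b := by
    intro a _
    split_ifs with ha
    · rw [hF j a, Finset.mul_prod_erase _ _ (Finset.mem_Ioi.2 ha)]
    · rw [Finset.erase_eq_of_notMem (by simpa using ha), one_mul]
  have h' : ∏ k ∈ Finset.univ.erase j, F j k = (∏ b ∈ Finset.Ioi j, F j b) *
      ∏ a ∈ Finset.univ.erase j, if a < j then F j a else 1 := by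
    rw [← Finset.prod_filter, ← Finset.prod_filter_mul_prod_filter_not (Finset.univ.erase j)
      (fun a => a < j), mul_comm]
    congr 1
    refine Finset.prod_congr ?_ fun _ _ => rfl
    ext a
    simp only [Finset.mem_filter, Finset.mem_erase, Finset.mem_univ, Finset.mem_Ioi]
    grind
  rw [← Finset.mul_prod_erase _ _ (Finset.mem_univ j), Finset.prod_congr rfl h,
    Finset.prod_mul_distrib, h', mul_assoc]

/-- Isolates the whole dependence on `σ j`, so that flipping this sign can be followed explicitly.
-/
theorem exists_Hcoeff_split {N M : ℕ} (η : ℂ) (ξ : Fin N → ℂ) (φ ψ : ℂ) (lam : Fin M → ℂ)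
    (j : Fin M) : ∃ r : (Fin M → ℤˣ) → ℂ, (∀ σ s, r (Function.update σ j s) = r σ) ∧
      ∀ σ, Hcoeff η ξ φ ψ σ lam = siteFactor η ξ φ ψ (σ j) (lam j) *
        (∏ k ∈ Finset.univ.erase j, pairFactor η (sgn (σ j) * lam j) (sgn (σ k) * lam k)) *
          r σ := by
  refine ⟨fun σ => (∏ n ∈ Finset.univ.erase j, siteFactor η ξ φ ψ (σ n) (lam n)) *
    ∏ a ∈ Finset.univ.erase j, ∏ b ∈ (Finset.Ioi a).erase j,
      pairFactor η (sgn (σ a) * lam a) (sgn (σ b) * lam b), fun σ s => ?_, fun σ => ?_⟩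
  · have h : ∀ {k}, k ≠ j → Function.update σ j s k = σ k :=
      fun hk => Function.update_of_ne hk _ _
    refine congrArg₂ _ (Finset.prod_congr rfl fun n hn => ?_)
      (Finset.prod_congr rfl fun a ha => Finset.prod_congr rfl fun b hb => ?_)
    · rw [h (Finset.ne_of_mem_erase hn)]
    · rw [h (Finset.ne_of_mem_erase ha), h (Finset.ne_of_mem_erase hb)]
  · rw [Hcoeff_eq, prod_prod_Ioi_eq_mul _ (fun a b => pairFactor_comm _ _ _) j,
      ← Finset.mul_prod_erase _ _ (Finset.mem_univ j)]
    ring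

theorem pairFactor_mul_exFactor_neg (η a b : ℂ) :
    pairFactor η (-a) b * exFactor η (-a - b) = pairFactor η a b * exFactor η (a - b) := by
  rw [exFactor_neg_sub, mul_comm, pairFactor, pairFactor, exFactor,
    show -a + b + η = -(a - b - η) by ring, show -a + b = -(a - b) by ring, Complex.sinh_neg,
    Complex.sinh_neg, neg_div_neg_eq]

theorem prod_Icc_one_succ (f : ℕ → ℂ) (M : ℕ) :
    ∏ j ∈ Finset.Icc 1 (M + 1), f j = f 1 * ∏ j ∈ Finset.Icc 1 M, f (j + 1) := by
  induction M with
  | zero => simp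
  | succ M ih =>
    rw [Finset.prod_Icc_succ_top (by omega), ih, Finset.prod_Icc_succ_top (by omega), mul_assoc]

/-- Passing from `y` to `y + 2` shifts the numerators by one index, so the factor `j = 1` splits off
there, whereas the denominators lose `j = M + 1`. The factor `sinh (η(δ + 1))` of the direct term
cancels the one from `boundaryBhat_decomposition`. -/
theorem hcoeff_succ (N M : ℕ) (η y γ δ : ℂ)
    (hden : ∀ j ∈ Finset.Icc 1 (M + 1), Complex.sinh (η * (δ + (j : ℂ))) ≠ 0) :
    hcoeff N (M + 1) η (γ - δ) y (γ + δ) =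
      (-1) ^ N * Complex.exp (η * (y + 1 + γ)) / (4 * Complex.sinh (η * (δ + 1))) *
        (Complex.exp (-(η * M)) * refFactor N η (y + 1) (γ + δ) *
          Complex.sinh (η * (δ + 1)) / Complex.sinh (η * (δ + 1 + M))) *
        hcoeff N M η (γ - δ) (y + 2) (γ + δ) := by
  have e1 : ∀ j : ℂ, (γ + δ - (γ - δ)) / 2 + j = δ + j := fun j => by ring
  have hd1 : Complex.sinh (η * (δ + 1)) ≠ 0 := by
    simpa using hden 1 (by simp)
  have hdM : Complex.sinh (η * (δ + 1 + M)) ≠ 0 := by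
    have := hden (M + 1) (by simp)
    push_cast at this
    rwa [add_assoc, add_comm (1 : ℂ)]
  have e2 : ∀ j : ℕ, (y - (γ + δ) + N - 1 + 2 * ((j + 1 : ℕ) : ℂ)) / 2 =
      (y + 2 - (γ + δ) + N - 1 + 2 * (j : ℂ)) / 2 := fun j => by push_cast; ring
  have e3 : (y - (γ + δ) + N - 1 + 2 * ((1 : ℕ) : ℂ)) / 2 = (y + 1 - (γ + δ) + N) / 2 := by
    push_cast; ring
  have e4 : δ + ((M + 1 : ℕ) : ℂ) = δ + 1 + M := by push_cast; ring
  have hexp : Complex.exp (((M + 1 : ℕ) : ℂ) * η * ((γ - δ + y + N) / 2)) =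
      Complex.exp (η * (y + 1 + γ)) * Complex.exp (-(η * M)) *
        Complex.exp (-η / 2 - η * ((y + 1 + (γ + δ) - N) / 2)) *
        Complex.exp ((M : ℂ) * η * ((γ - δ + (y + 2) + N) / 2)) := by
    rw [← Complex.exp_add, ← Complex.exp_add, ← Complex.exp_add]
    congr 1
    push_cast
    ring
  simp only [hcoeff, refFactor, e1, Finset.prod_div_distrib]
  rw [prod_Icc_one_succ (fun j => Complex.sinh (η * ((y - (γ + δ) + N - 1 + 2 * (j : ℂ)) / 2))),
    Finset.prod_Icc_succ_top (by omega)]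
  simp only [e3]
  simp only [e2, e4]
  rw [hexp, show (M + 1) * N = M * N + N by ring, pow_add]
  have hp : ∏ j ∈ Finset.Icc 1 M, 2 * Complex.sinh (η * (δ + (j : ℂ))) ≠ 0 :=
    Finset.prod_ne_zero_iff.2 fun j hj => mul_ne_zero two_ne_zero
      (hden j (by rw [Finset.mem_Icc] at *; omega))
  field_simp
  ring

theorem sgn_neg (s : ℤˣ) : sgn (-s) = -sgn s := by simp [sgn]

theorem sinh_sgn_add_sgn {a b : ℂ} (h₁ : Complex.sinh (a + b) ≠ 0) (h₂ : Complex.sinh (a - b) ≠ 0)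
    (s t : ℤˣ) : Complex.sinh (sgn s * a + sgn t * b) ≠ 0 := by
  rcases sgn_eq_or s with hs | hs <;> rcases sgn_eq_or t with ht | ht <;> rw [hs, ht]
  · simpa using h₁
  · simpa [← sub_eq_add_neg] using h₂
  · rw [show -1 * a + 1 * b = -(a - b) by ring, Complex.sinh_neg]
    exact neg_ne_zero.2 h₂
  · rw [show -1 * a + -1 * b = -(a + b) by ring, Complex.sinh_neg]
    exact neg_ne_zero.2 h₁

theorem univ_units_sum {V : Type*} [AddCommGroup V] (f : ℤˣ → V) : ∑ s, f s = f 1 + f (-1) := by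
  have hs : (Finset.univ : Finset ℤˣ) = {1, -1} := rfl
  rw [hs, Finset.sum_pair (by decide)]

/-- The coefficients of an exchanged term cancel between the two values of the sign `σ j`. -/
theorem unwanted_coeff_cancel {N M : ℕ} {η ς κ φ ψ δ : ℂ} (ξ : Fin N → ℂ) (hκ : κ ≠ 0)
    (h₁ : Complex.sinh φ * Complex.cosh ψ = Complex.sinh ς / (2 * κ))
    (h₂ : Complex.cosh φ * Complex.sinh ψ = Complex.cosh ς / (2 * κ)) (ε : ℤˣ)
    (hδ : η * δ = -sgn ε * (φ + ψ) - Complex.I * Real.pi / 2) (l : ℂ) (lam : Fin M → ℂ)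
    (j : Fin M) (hadd : Complex.sinh (l + lam j) ≠ 0) (hsub : Complex.sinh (l - lam j) ≠ 0)
    (Z : (Fin M → ℤˣ) → ℂ)
    (hZ : ∀ σ, Z σ = ∑ s : ℤˣ, sgn s * aBoundary η (sgn ε * φ) (sgn ε * ψ) (-(sgn s * l)) *
      Hcoeff η ξ (sgn ε * φ) (sgn ε * ψ) σ lam *
      ((Complex.sinh (-(sgn s * l) - sgn (σ j) * lam j + η * (δ + 1)) /
        Complex.sinh (-(sgn s * l) - sgn (σ j) * lam j)) * aFun η ξ (sgn (σ j) * lam j) *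
        ∏ k ∈ Finset.univ.erase j, exFactor η (sgn (σ j) * lam j - sgn (σ k) * lam k)))
    (σ : Fin M → ℤˣ) : Z σ + Z (Function.update σ j (-σ j)) = 0 := by
  obtain ⟨r, hr, hH⟩ := exists_Hcoeff_split η ξ (sgn ε * φ) (sgn ε * ψ) lam j
  set P : ℂ → ℂ := fun u => aBoundary η (sgn ε * φ) (sgn ε * ψ) u with hP
  set G : ℂ → ℂ := fun v => ∏ k ∈ Finset.univ.erase j,
    (pairFactor η v (sgn (σ k) * lam k) * exFactor η (v - sgn (σ k) * lam k)) with hG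
  -- The factors coupling `j` to the other parameters are even in `σⱼλⱼ`, as is `a(v) a(-v)`; only
  -- the boundary part feels the flip.
  have hGneg : ∀ v, G (-v) = G v := fun v =>
    Finset.prod_congr rfl fun k _ => pairFactor_mul_exFactor_neg η v _
  set q := Complex.sinh (2 * lam j - η) / Complex.sinh (2 * lam j) with hq
  have hZt : ∀ t, Z (Function.update σ j t) = ∑ s : ℤˣ, sgn s * P (-(sgn s * l)) *
      (sgn t * aFun η ξ (-(sgn t * lam j)) * P (-(sgn t * lam j)) * q) * r σ *
      ((Complex.sinh (-(sgn s * l) - sgn t * lam j + η * (δ + 1)) /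
        Complex.sinh (-(sgn s * l) - sgn t * lam j)) * aFun η ξ (sgn t * lam j) *
        G (sgn t * lam j)) := by
    intro t
    have hu : ∀ k ∈ Finset.univ.erase j, Function.update σ j t k = σ k := fun k hk =>
      Function.update_of_ne (Finset.ne_of_mem_erase hk) _ _
    have hp₁ : ∏ k ∈ Finset.univ.erase j, pairFactor η (sgn t * lam j)
        (sgn (Function.update σ j t k) * lam k) =
        ∏ k ∈ Finset.univ.erase j, pairFactor η (sgn t * lam j) (sgn (σ k) * lam k) :=
      Finset.prod_congr rfl fun k hk => by rw [hu k hk]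
    have hp₂ : ∏ k ∈ Finset.univ.erase j, exFactor η (sgn t * lam j -
        sgn (Function.update σ j t k) * lam k) =
        ∏ k ∈ Finset.univ.erase j, exFactor η (sgn t * lam j - sgn (σ k) * lam k) :=
      Finset.prod_congr rfl fun k hk => by rw [hu k hk]
    rw [hZ]
    refine Finset.sum_congr rfl fun s _ => ?_
    rw [hH, hr, Function.update_self, hp₁, hp₂]
    simp only [hG, hP, hq, Finset.prod_mul_distrib, siteFactor]
    ring
  have hσ := hZt (σ j)
  rw [Function.update_eq_self] at hσ
  rw [hσ, hZt, univ_units_sum, univ_units_sum]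
  have h1 : sgn 1 = 1 := by simp [sgn]
  have hb₁ := sinh_sgn_add_sgn hadd hsub 1 (σ j)
  have hb₂ := sinh_sgn_add_sgn hadd hsub 1 (-σ j)
  rw [sgn_neg, neg_mul, ← sub_eq_add_neg] at hb₂
  simp only [sgn_neg, h1, neg_mul, one_mul, neg_neg, hGneg] at hb₁ hb₂ ⊢
  generalize sgn (σ j) * lam j = v at *
  have h := boundary_cancellation hκ h₁ h₂ ε hδ l v hb₁ hb₂ P (fun _ => rfl)
  rw [show -l - v = -(l + v) by ring, show -l - -v = -(l - v) by ring, sub_neg_eq_add]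
  linear_combination (sgn (σ j) * aFun η ξ v * aFun η ξ (-v) * q * r σ * G v) * h

/-! ### The induction on the number of boundary operators. -/

theorem bulkB_sgn_comm {N : ℕ} (η : ℂ) (ξ : Fin N → ℂ) (s : ℤˣ) (l x y : ℂ) :
    bulkB η ξ (sgn s * l) (x - 1) y * bulkB η ξ (-(sgn s * l)) (x - 2) (y + 1) =
      bulkB η ξ l (x - 1) y * bulkB η ξ (-l) (x - 2) (y + 1) := by
  rcases sgn_eq_or s with e | e <;> rw [e]
  · rw [one_mul]
  · have h := bulkB_comm η ξ (-l) l (x - 2) y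
    rw [show x - 2 + 1 = x - 1 by ring] at h
    rw [neg_one_mul, neg_neg, h]

/-- One term of the decomposition applied to one term of the induction hypothesis. Here `w = γ + δ`
and `x = γ - δ`, so `D = δ + 1`, which is the origin of the denominators `sinh (η(δ + j))`. -/
theorem bulkB_mul_bulkB_mulVec {N M : ℕ} (η : ℂ) (ξ : Fin N → ℂ) (s : ℤˣ) (l y γ δ : ℂ)
    (ν : Fin M → ℂ)
    (hden : ∀ j ∈ Finset.Icc 1 (M + 1), Complex.sinh (η * (δ + (j : ℂ))) ≠ 0)
    (hμ : ∀ i, Complex.sinh (-(sgn s * l) - ν i) ≠ 0)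
    (hν : ∀ i j, i ≠ j → Complex.sinh (ν i - ν j) ≠ 0) :
    (bulkB η ξ (sgn s * l) (γ - δ - 1) y * bulkB η ξ (-(sgn s * l)) (γ + δ) (y + 1)) *ᵥ
        (bulkBProd η ξ ν (γ - δ) (y + 2) *ᵥ refState η ξ (γ + δ + M)) =
      (Complex.exp (-(η * M)) * refFactor N η (y + 1) (γ + δ) /
        Complex.sinh (η * (δ + 1 + M))) •
      ((Complex.sinh (η * (δ + 1)) * aFun η ξ (-(sgn s * l)) *
          ∏ k, pairFactor η (sgn s * l) (ν k)) •
          bulkBProd η ξ (Fin.cons (sgn s * l) ν : Fin (M + 1) → ℂ) (γ - δ) y *ᵥ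
            refState η ξ (γ + δ + (M + 1 : ℕ)) +
        ∑ j, (Complex.sinh η * ((Complex.sinh (-(sgn s * l) - ν j + η * (δ + 1)) /
            Complex.sinh (-(sgn s * l) - ν j)) * aFun η ξ (ν j) *
            ∏ k ∈ Finset.univ.erase j, exFactor η (ν j - ν k))) •
          (bulkB η ξ l (γ - δ - 1) y * bulkB η ξ (-l) (γ - δ - 2) (y + 1) *
            bulkBSet η ξ ν (Finset.univ.erase j) (γ - δ - 3) (y + 2)) *ᵥ
              refState η ξ (γ + δ + (M + 1 : ℕ))) := by
  have hc : Complex.sinh (η * (δ + 1 + M)) ≠ 0 := by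
    have := hden (M + 1) (by simp)
    push_cast at this
    rwa [add_assoc, add_comm (1 : ℂ)]
  have h := bulkB_mulVec_bulkBSet η ξ ν Finset.univ (-(sgn s * l)) (γ + δ) (γ - δ) (y + 1) (δ + 1)
    (by ring) (fun i _ => hμ i) (fun i _ j _ => hν i j) (by
      intro j hj
      rw [Finset.card_univ, Fintype.card_fin, Finset.mem_Icc] at hj
      have := hden (j + 1) (Finset.mem_Icc.2 (by omega))
      push_cast at this
      rwa [add_assoc, add_comm (1 : ℂ)])
  rw [Finset.card_univ, Fintype.card_fin, show y + 1 + 1 = y + 2 by ring] at h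
  rw [bulkBProd_succ, bulkBProd_eq_bulkBSet, bulkBProd_eq_bulkBSet]
  simp only [Fin.cons_zero, Fin.cons_succ]
  rw [show γ - δ - 1 - 1 = γ - δ - 2 by ring, Nat.cast_succ, ← add_assoc (γ + δ)]
  have h' : (bulkB η ξ (-(sgn s * l)) (γ + δ) (y + 1) *
      bulkBSet η ξ ν Finset.univ (γ - δ - 1) (y + 2)) *ᵥ refState η ξ (γ + δ + M) =
      (Complex.sinh (η * (δ + 1 + M)))⁻¹ • Complex.sinh (η * (δ + 1 + M)) •
        (bulkB η ξ (-(sgn s * l)) (γ + δ) (y + 1) *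
          bulkBSet η ξ ν Finset.univ (γ - δ - 1) (y + 2)) *ᵥ refState η ξ (γ + δ + M) := by
    rw [smul_smul, inv_mul_cancel₀ hc, one_smul]
  rw [h] at h'
  rw [Matrix.mulVec_mulVec, mul_assoc, ← Matrix.mulVec_mulVec, h']
  simp only [Matrix.mulVec_smul, Matrix.mulVec_add, Matrix.mulVec_sum, Matrix.mulVec_mulVec,
    ← mul_assoc, bulkB_sgn_comm, exFactor_neg_sub, smul_smul]
  congr 1
  ring

theorem bulkBSet_update {N M : ℕ} (η : ℂ) (ξ : Fin N → ℂ) (σ : Fin M → ℤˣ) (lam : Fin M → ℂ)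
    (j : Fin M) (s : ℤˣ) (x y : ℂ) :
    bulkBSet η ξ (fun n => sgn (Function.update σ j s n) * lam n) (Finset.univ.erase j) x y =
      bulkBSet η ξ (fun n => sgn (σ n) * lam n) (Finset.univ.erase j) x y :=
  bulkBSet_congr _ _ (fun i hi => by rw [Function.update_of_ne (Finset.ne_of_mem_erase hi)]) _ _

theorem boundaryBhatProd_succ {N M : ℕ} (η : ℂ) (ξ : Fin N → ℂ) (ς κ τ : ℂ)
    (lam : Fin (M + 1) → ℂ) (z : ℂ) : boundaryBhatProd η ξ ς κ τ lam z =
      boundaryBhat η ξ ς κ τ (lam 0) z *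
        boundaryBhatProd η ξ ς κ τ (fun k => lam k.succ) (z + 2) := by
  rw [boundaryBhatProd, List.ofFn_succ, List.prod_cons, boundaryBhatProd]
  simp only [Fin.val_zero, Fin.val_succ, Nat.cast_zero, mul_zero, add_zero]
  refine congrArg (fun f => _ * (List.ofFn f).prod) (funext fun k => ?_)
  rw [show z + 2 * (((k : ℕ) + 1 : ℕ) : ℂ) = z + 2 + 2 * (k : ℕ) by push_cast; ring]

theorem boundaryBhatProd_mulVec_refState {N : ℕ} {η : ℂ} (ξ : Fin N → ℂ) {ς κ τ φ ψ γ δ : ℂ}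
    (hς : Complex.sinh ς ≠ 0) (hκ : κ ≠ 0)
    (h₁ : Complex.sinh φ * Complex.cosh ψ = Complex.sinh ς / (2 * κ))
    (h₂ : Complex.cosh φ * Complex.sinh ψ = Complex.cosh ς / (2 * κ)) (ε : ℤˣ)
    (hγ : η * γ = -τ + sgn ε * (Complex.I * Real.pi / 2))
    (hδ : η * δ = -sgn ε * (φ + ψ) - Complex.I * Real.pi / 2) (M : ℕ) (y : ℂ) (lam : Fin M → ℂ)
    (hden : ∀ j ∈ Finset.Icc 1 M, Complex.sinh (η * (δ + (j : ℂ))) ≠ 0)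
    (hlam : ∀ n, Complex.sinh (2 * lam n) ≠ 0)
    (hadd : ∀ a b, a ≠ b → Complex.sinh (lam a + lam b) ≠ 0)
    (hsub : ∀ a b, a ≠ b → Complex.sinh (lam a - lam b) ≠ 0) :
    boundaryBhatProd η ξ ς κ τ lam (y + 1) *ᵥ refState η ξ (γ + δ) =
      hcoeff N M η (γ - δ) y (γ + δ) • ∑ σ : Fin M → ℤˣ,
        Hcoeff η ξ (sgn ε * φ) (sgn ε * ψ) σ lam •
          (bulkBProd η ξ (fun n => sgn (σ n) * lam n) (γ - δ) y *ᵥ refState η ξ (γ + δ + M)) := by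
  induction M generalizing y with
  | zero => simp [boundaryBhatProd, bulkBProd, hcoeff, Hcoeff]
  | succ M ih =>
    have hd1 : Complex.sinh (η * (δ + 1)) ≠ 0 := by simpa using hden 1 (by simp)
    have ih' := ih (y + 2) (fun k => lam k.succ)
      (fun j hj => hden j (by rw [Finset.mem_Icc] at *; omega)) (fun n => hlam n.succ)
      (fun a b hab => hadd _ _ (by simpa using hab)) (fun a b hab => hsub _ _ (by simpa using hab))
    have hν : ∀ (σ : Fin M → ℤˣ) (i j : Fin M), i ≠ j →
        Complex.sinh (sgn (σ i) * lam i.succ - sgn (σ j) * lam j.succ) ≠ 0 := by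
      intro σ i j hij
      have h := sinh_sgn_add_sgn (hadd i.succ j.succ (by simpa using hij))
        (hsub i.succ j.succ (by simpa using hij)) (σ i) (-σ j)
      rwa [sgn_neg, neg_mul, ← sub_eq_add_neg] at h
    have hμ : ∀ (s : ℤˣ) (σ : Fin M → ℤˣ) (i : Fin M),
        Complex.sinh (-(sgn s * lam 0) - sgn (σ i) * lam i.succ) ≠ 0 := by
      intro s σ i
      have h := sinh_sgn_add_sgn (hadd 0 i.succ (Fin.succ_ne_zero i).symm)
        (hsub 0 i.succ (Fin.succ_ne_zero i).symm) (-s) (-σ i)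
      rwa [sgn_neg, sgn_neg, neg_mul, neg_mul, ← sub_eq_add_neg] at h
    have hterm := fun (s : ℤˣ) (σ : Fin M → ℤˣ) => bulkB_mul_bulkB_mulVec η ξ s (lam 0) y γ δ
      (fun n => sgn (σ n) * lam n.succ) hden (hμ s σ) (hν σ)
    set v := refState η ξ (γ + δ + (M + 1 : ℕ)) with hv
    set p := sgn ε * φ with hp
    set r := sgn ε * ψ with hr
    set K := Complex.exp (-(η * M)) * refFactor N η (y + 1) (γ + δ) /
        Complex.sinh (η * (δ + 1 + M)) with hK
    set q := Complex.sinh (2 * lam 0 - η) / Complex.sinh (2 * lam 0) with hq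
    set U : (Fin M → ℤˣ) → Fin M → State N := fun σ j =>
      (bulkB η ξ (lam 0) (γ - δ - 1) y * bulkB η ξ (-lam 0) (γ - δ - 2) (y + 1) *
        bulkBSet η ξ (fun n => sgn (σ n) * lam n.succ) (Finset.univ.erase j) (γ - δ - 3)
          (y + 2)) *ᵥ v with hU
    set Z : Fin M → (Fin M → ℤˣ) → ℂ := fun j σ => ∑ s : ℤˣ, sgn s *
      aBoundary η p r (-(sgn s * lam 0)) * Hcoeff η ξ p r σ (fun k => lam k.succ) *
      ((Complex.sinh (-(sgn s * lam 0) - sgn (σ j) * lam j.succ + η * (δ + 1)) /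
        Complex.sinh (-(sgn s * lam 0) - sgn (σ j) * lam j.succ)) *
        aFun η ξ (sgn (σ j) * lam j.succ) *
        ∏ k ∈ Finset.univ.erase j, exFactor η (sgn (σ j) * lam j.succ - sgn (σ k) * lam k.succ))
      with hZ
    -- Flipping `σ j` is a fixed-point-free involution that leaves the vector `U σ j` unchanged.
    have hcancel : ∀ j, ∑ σ, Z j σ • U σ j = 0 := by
      intro j
      refine Finset.sum_involution (fun σ _ => Function.update σ j (-σ j)) (fun σ _ => ?_)
        (fun σ _ _ h => ?_) (fun _ _ => Finset.mem_univ _) (fun σ _ => ?_)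
      · have hUu : U (Function.update σ j (-σ j)) j = U σ j := by
          simp only [hU]
          rw [bulkBSet_update η ξ σ (fun k => lam k.succ)]
        rw [hUu, ← add_smul, unwanted_coeff_cancel ξ hκ h₁ h₂ ε hδ (lam 0) (fun k => lam k.succ) j
          (hadd 0 j.succ (Fin.succ_ne_zero j).symm) (hsub 0 j.succ (Fin.succ_ne_zero j).symm)
          (Z j) (fun _ => rfl), zero_smul]
      · have := congrFun h j
        rw [Function.update_self] at this
        exact absurd this (by rcases Int.units_eq_one_or (σ j) with e | e <;> rw [e] <;> decide)
      · simp
    have hwanted : ∀ (s : ℤˣ) (σ : Fin M → ℤˣ), bulkBProd η ξ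
        (Fin.cons (sgn s * lam 0) (fun n => sgn (σ n) * lam n.succ) : Fin (M + 1) → ℂ) (γ - δ) y =
        bulkBProd η ξ (fun n => sgn ((Fin.cons s σ : Fin (M + 1) → ℤˣ) n) * lam n) (γ - δ) y := by
      intro s σ
      congr 1
      funext n
      refine Fin.cases ?_ (fun k => ?_) n <;> simp
    rw [boundaryBhatProd_succ, ← Matrix.mulVec_mulVec, show y + 1 + 2 = y + 2 + 1 by ring, ih',
      boundaryBhat_decomposition ξ hς hκ h₁ h₂ ε hγ hδ hd1 (hlam 0), hcoeff_succ N M η y γ δ hden]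
    set c₀ := (-1) ^ N * Complex.exp (η * (y + 1 + γ)) / (4 * Complex.sinh (η * (δ + 1))) with hc₀
    set hM := hcoeff N M η (γ - δ) (y + 2) (γ + δ) with hhM
    calc _ = (c₀ * hM) • ∑ s : ℤˣ, ∑ σ : Fin M → ℤˣ, (sgn s * aBoundary η p r (-(sgn s * lam 0)) *
          q * Hcoeff η ξ p r σ (fun k => lam k.succ)) •
          ((bulkB η ξ (sgn s * lam 0) (γ - δ - 1) y *
            bulkB η ξ (-(sgn s * lam 0)) (γ + δ) (y + 1)) *ᵥ
            (bulkBProd η ξ (fun n => sgn (σ n) * lam n.succ) (γ - δ) (y + 2) *ᵥ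
              refState η ξ (γ + δ + M))) := by
          rw [Matrix.smul_mulVec, Matrix.mulVec_smul, smul_smul, Matrix.sum_mulVec]
          congr 1
          refine Finset.sum_congr rfl fun s _ => ?_
          rw [Matrix.mulVec_sum]
          refine Finset.sum_congr rfl fun σ _ => ?_
          rw [Matrix.smul_mulVec, Matrix.mulVec_smul, smul_smul]
      _ = (c₀ * hM * K) • (∑ s : ℤˣ, ∑ σ : Fin M → ℤˣ,
          (Complex.sinh (η * (δ + 1)) * Hcoeff η ξ p r (Fin.cons s σ : Fin (M + 1) → ℤˣ) lam) •
            (bulkBProd η ξ (fun n => sgn ((Fin.cons s σ : Fin (M + 1) → ℤˣ) n) * lam n)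
              (γ - δ) y *ᵥ v) + (q * Complex.sinh η) • ∑ j, ∑ σ, Z j σ • U σ j) := by
          have hZU : ∑ j, ∑ σ, Z j σ • U σ j = ∑ s : ℤˣ, ∑ σ, ∑ j, (sgn s *
              aBoundary η p r (-(sgn s * lam 0)) * Hcoeff η ξ p r σ (fun k => lam k.succ) *
              ((Complex.sinh (-(sgn s * lam 0) - sgn (σ j) * lam j.succ + η * (δ + 1)) /
                Complex.sinh (-(sgn s * lam 0) - sgn (σ j) * lam j.succ)) *
                aFun η ξ (sgn (σ j) * lam j.succ) *
                ∏ k ∈ Finset.univ.erase j,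
                  exFactor η (sgn (σ j) * lam j.succ - sgn (σ k) * lam k.succ))) • U σ j := by
            simp only [hZ, Finset.sum_smul]
            rw [Finset.sum_comm, Finset.sum_comm (s := (Finset.univ : Finset ℤˣ))]
            exact Finset.sum_congr rfl fun σ _ => Finset.sum_comm
          rw [hZU, mul_smul _ K]
          congr 1
          rw [Finset.smul_sum, ← Finset.sum_add_distrib, Finset.smul_sum]
          refine Finset.sum_congr rfl fun s _ => ?_
          rw [Finset.smul_sum, ← Finset.sum_add_distrib, Finset.smul_sum]
          refine Finset.sum_congr rfl fun σ _ => ?_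
          rw [hterm, hwanted, Hcoeff_cons, siteFactor, smul_comm, smul_add, smul_smul]
          congr 2
          · congr 1
            simp only [hq]
            ring
          · rw [Finset.smul_sum, Finset.smul_sum]
            refine Finset.sum_congr rfl fun j _ => ?_
            rw [smul_smul, smul_smul]
            congr 1
            ring
      _ = _ := by
          simp only [hcancel, Finset.sum_const_zero, smul_zero, add_zero]
          -- The sign `s` from the decomposition becomes the component `σ 0` of the enlarged sign
          -- vector.
          rw [← Equiv.sum_comp (Fin.consEquiv fun _ => ℤˣ), Fintype.sum_prod_type, Finset.smul_sum,
            Finset.smul_sum]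
          refine Finset.sum_congr rfl fun s _ => ?_
          rw [Finset.smul_sum, Finset.smul_sum]
          refine Finset.sum_congr rfl fun σ _ => ?_
          have hcons : (Fin.consEquiv fun _ => ℤˣ) (s, σ) = (Fin.cons s σ : Fin (M + 1) → ℤˣ) :=
            rfl
          rw [smul_smul, smul_smul, hcons]
          congr 1
          simp only [hK]
          ring

end OpenXXZ

theorem mainTheorem3 (N M : ℕ) (η : ℂ) (ξ : Fin N → ℂ)
    -- the parameters of the boundary matrix `K₋`
    (ς κ τ φ ψ : ℂ) (hς : Complex.sinh ς ≠ 0) (hκ : κ ≠ 0)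
    (hφψ₁ : Complex.sinh φ * Complex.cosh ψ = Complex.sinh ς / (2 * κ))
    (hφψ₂ : Complex.cosh φ * Complex.sinh ψ = Complex.cosh ς / (2 * κ))
    -- the internal gauge parameters
    (ε : ℤˣ) (γ δ : ℂ)
    (hγ : η * γ = -τ + OpenXXZ.sgn ε * (Complex.I * Real.pi / 2))
    (hδ : η * δ = -OpenXXZ.sgn ε * (φ + ψ) - Complex.I * Real.pi / 2)
    -- the external gauge parameters and the spectral parameters
    (α β : ℂ) (lam : Fin M → ℂ)
    -- the denominators of the coefficients do not vanish
    (hden : ∀ j ∈ Finset.Icc 1 M, Complex.sinh (η * (δ + (j : ℂ))) ≠ 0)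
    (hlam : ∀ n, Complex.sinh (2 * lam n) ≠ 0)
    (hadd : ∀ a b, a ≠ b → Complex.sinh (lam a + lam b) ≠ 0)
    (hsub : ∀ a b, a ≠ b → Complex.sinh (lam a - lam b) ≠ 0) :
    OpenXXZ.boundaryBhatProd η ξ ς κ τ lam (α - β + 1) *ᵥ OpenXXZ.refState η ξ (γ + δ) =
      OpenXXZ.hcoeff N M η (γ - δ) (α - β) (γ + δ) •
        ∑ σ : Fin M → ℤˣ,
          OpenXXZ.Hcoeff η ξ (OpenXXZ.sgn ε * φ) (OpenXXZ.sgn ε * ψ) σ lam •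
            (OpenXXZ.bulkBProd η ξ (fun n => OpenXXZ.sgn (σ n) * lam n) (γ - δ) (α - β) *ᵥ
              OpenXXZ.refState η ξ (γ + δ + M)) := by
  exact OpenXXZ.boundaryBhatProd_mulVec_refState ξ hς hκ hφψ₁ hφψ₂ ε hγ hδ M (α - β) lam hden hlam
    hadd hsub
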